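/- Let $a,\epsilon>0$ and $c=a\epsilon$. Functions are complex-valued, $\langle u,v\rangle=\int u\overline v$, and $\mathcal F[f](x)=\int e^{ibx}f(b)\,db$ denotes the Fourier transform on $L^2(\mathbb R)$. Let $PW(a)=\{f\in L^2(\mathbb R):\operatorname{supp}\mathcal F[f]\subseteq[-a,a]\}$ and let $\mathcal P_a[f]=\mathcal F^{-1}\big[\mathbf 1_{[-a,a]}\mathcal F[f]\big]$ be the projector of $L^2(\mathbb R)$ onto $PW(a)$. Let $\mathcal F_c:L^2([-1,1])\to L^2([-1,1])$, $\mathcal F_c[\varphi](x)=\int_{-1}^1e^{icbx}\varphi(b)\,db$. The operator $\mathcal F_c$ has a singular value decomposition $(\sigma_m,\varphi_m,g_m)_{m\ge0}$ with $\sigma_0\ge\sigma_1\ge\dots>0$, $(\varphi_m)$ and $(g_m)$ orthonormal in $L^2([-1,1])$, $\mathcal F_c\varphi_m=\sigma_mg_m$, $\mathcal F_c^*g_m=\sigma_m\varphi_m$ and $\mathcal F_cf=\sum_m\sigma_m\langle f,\varphi_m\rangle g_m$ for all $f\in L^2([-1,1])$. Take any such decomposition. Denote again by $g_m$ the extension of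 $g_m$ to an entire function, $g_m(x)=\sigma_m^{-1}\int_{-1}^1e^{icbx}\varphi_m(b)\,db$ (the prolate spheroidal wave functions), put $$\rho_m=\frac{c\,\sigma_m^2}{2\pi},\qquad C_0(c)=\frac{4c}{\pi(1-\rho_0)^2},$$ and, for $h\in L^2(\mathbb R)$, $$\mathcal I_{a,\epsilon}[h]=\sum_{m\ge0}\frac{\rho_m\,\big\langle h,g_m(\cdot/\epsilon)\big\rangle_{L^2(\mathbb R\setminus(-\epsilon,\epsilon))}}{(1-\rho_m)\,\epsilon}\;g_m(\cdot/\epsilon).$$ Then: 1. $\rho_m<1$ for all $m$; for all $h\in L^2(\mathbb R)$ the series $\mathcal I_{a,\epsilon}[h]$ converges in $L^2(\mathbb R)$, and its restriction to $[-\epsilon,\epsilon]$ is the sum in $L^2([-\epsilon,\epsilon])$ of the series of the restrictions; in particular $\mathcal I_{a,\epsilon}(L^2(\mathbb R))\subseteq L^2([-\epsilon,\epsilon])$. 2. For all $g\in PW(a)$, $\mathcal I_{a,\epsilon}[g]=g$ in $L^2(\mathbb R)$. 3. For all $f,h\in L^2(\mathbb R)$, $$\big\|f-\mathcal I_{a,\epsilon}[h]\big\|_{L^2([-\epsilon,\epsilon])}^2\le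 2\big(1+C_0(a\epsilon)\big)\big\|f-\mathcal P_a[f]\big\|_{L^2(\mathbb R)}^2+2C_0(a\epsilon)\big\|f-h\big\|_{L^2(\mathbb R\setminus(-\epsilon,\epsilon))}^2 .$$ -/

import Mathlib

open MeasureTheory Set Filter
open scoped FourierTransform ContDiff ComplexConjugate ENNReal

namespace PSWF

/-- `L²(ℝ)`: complex-valued, Lebesgue measure. -/
abbrev L2R : Type := Lp ℂ 2 (volume : Measure ℝ)

/-- `L²([-1,1])`. -/
abbrev L2I : Type := Lp ℂ 2 ((volume : Measure ℝ).restrict (Icc (-1) 1))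

/-! ### The Paley–Wiener space and its projector -/

/-- The Fourier transform on `L²(ℝ)` in the normalisation
`F[f](x) = ∫ exp(i b x) f(b) db`, i.e. `F[f](x) = 𝓕 f (-x / (2π))` in terms of Mathlib's
unitary transform `𝓕 f(ξ) = ∫ exp(-2π i b ξ) f(b) db`. Defined up to null sets. -/
noncomputable def fourierL2 (f : L2R) (x : ℝ) : ℂ :=
  (𝓕 f : L2R) (-x / (2 * Real.pi))

/-- `PW(c)`: the functions of `L²(ℝ)` whose Fourier transform is supported in `[-c,c]`. -/
def paleyWiener (c : ℝ) : Set L2R :=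
  {f | ∀ᵐ x : ℝ, x ∉ Icc (-c) c → fourierL2 f x = 0}

/-- The projector onto `PW(c)`: the Fourier transform is multiplied by the indicator of
`[-c,c]`. A frequency `ξ` of Mathlib's transform corresponds to `x = -2πξ` above. -/
noncomputable def paleyWienerProj (c : ℝ) (f : L2R) : L2R :=
  𝓕⁻ ((((Lp.memLp (𝓕 f : L2R)).indicator
    (s := {ξ : ℝ | -(2 * Real.pi * ξ) ∈ Icc (-c) c})
    (measurableSet_Icc.preimage (by fun_prop)))).toLp _ : L2R)

/-- `F[P_c f] = 1_{[-c,c]} F[f]`. -/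
theorem fourierL2_paleyWienerProj (c : ℝ) (f : L2R) :
    fourierL2 (paleyWienerProj c f) =ᵐ[volume] (Icc (-c) c).indicator (fourierL2 f) := by
  have hπ : (-(2 * Real.pi)⁻¹ : ℝ) ≠ 0 := by
    simp [Real.pi_ne_zero]
  have h0 := ((Lp.memLp (𝓕 f : L2R)).indicator
    (s := {ξ : ℝ | -(2 * Real.pi * ξ) ∈ Icc (-c) c})
    (measurableSet_Icc.preimage (by fun_prop))).coeFn_toLp
  have hq : Measure.QuasiMeasurePreserving (fun x : ℝ => -(2 * Real.pi)⁻¹ * x) volume volume := by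
    refine ⟨by fun_prop, ?_⟩
    rw [Real.map_volume_mul_left hπ]
    exact Measure.smul_absolutelyContinuous
  have h1 := hq.ae h0
  filter_upwards [h1] with x hx
  have hx' : -x / (2 * Real.pi) = -(2 * Real.pi)⁻¹ * x := by
    rw [div_eq_inv_mul]; ring
  have hx2 : -(2 * Real.pi * (-(2 * Real.pi)⁻¹ * x)) = x := by
    field_simp
  unfold fourierL2 paleyWienerProj
  rw [FourierTransform.fourier_fourierInv_eq, hx', hx]
  by_cases hm : x ∈ Icc (-c) c
  · rw [indicator_of_mem hm, indicator_of_mem (by rw [mem_ofPred_eq, hx2]; exact hm), hx']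
  · rw [indicator_of_notMem hm, indicator_of_notMem (by rw [mem_ofPred_eq, hx2]; exact hm)]

/-! ### The truncated Fourier operator -/

/-- The entire function `F[φ](c x) = ∫_{-1}^{1} exp(i c b x) φ(b) db` (for real `x`), where
`φ ∈ L²([-1,1])` is extended by zero. -/
noncomputable def truncFourierFun (c : ℝ) (φ : L2I) (x : ℝ) : ℂ :=
  ∫ b in Icc (-1 : ℝ) 1, Complex.exp (Complex.I * ((c * b * x : ℝ) : ℂ)) * φ b

theorem L2I_integrable (φ : L2I) : Integrable φ (volume.restrict (Icc (-1 : ℝ) 1)) :=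
  (Lp.memLp φ).integrable (by norm_num)

theorem truncFourier_integrand_integrable (c : ℝ) (φ : L2I) (x : ℝ) :
    Integrable (fun b : ℝ => Complex.exp (Complex.I * ((c * b * x : ℝ) : ℂ)) * φ b)
      (volume.restrict (Icc (-1 : ℝ) 1)) := by
  refine (L2I_integrable φ).bdd_mul (c := 1) (by fun_prop) ?_
  refine Eventually.of_forall fun b => ?_
  rw [mul_comm Complex.I, Complex.norm_exp_ofReal_mul_I]

theorem truncFourierFun_continuous (c : ℝ) (φ : L2I) : Continuous (truncFourierFun c φ) := by
  refine continuous_of_dominated (bound := fun b => ‖φ b‖)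
    (fun x => (truncFourier_integrand_integrable c φ x).aestronglyMeasurable) ?_
    (L2I_integrable φ).norm ?_
  · intro x
    refine Eventually.of_forall fun b => ?_
    rw [norm_mul, mul_comm Complex.I, Complex.norm_exp_ofReal_mul_I, one_mul]
  · refine Eventually.of_forall fun b => ?_
    fun_prop

theorem norm_truncFourierFun_le (c : ℝ) (φ : L2I) (x : ℝ) :
    ‖truncFourierFun c φ x‖ ≤ Real.sqrt 2 * ‖φ‖ := by
  have h1 : ‖truncFourierFun c φ x‖ ≤ ∫ b in Icc (-1 : ℝ) 1, ‖φ b‖ := by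
    refine (norm_integral_le_integral_norm _).trans (le_of_eq ?_)
    refine integral_congr_ae (Eventually.of_forall fun b => ?_)
    simp only [norm_mul]
    rw [mul_comm Complex.I, Complex.norm_exp_ofReal_mul_I, one_mul]
  have h2 : eLpNorm φ 1 (volume.restrict (Icc (-1 : ℝ) 1)) ≤
      eLpNorm φ 2 (volume.restrict (Icc (-1 : ℝ) 1)) * ENNReal.ofReal (Real.sqrt 2) := by
    refine (eLpNorm_le_eLpNorm_mul_rpow_measure_univ (p := 1) (q := 2) (by norm_num)
      (Lp.aestronglyMeasurable φ)).trans (le_of_eq ?_)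
    congr 1
    rw [Measure.restrict_apply_univ, Real.volume_Icc, ENNReal.ofReal_rpow_of_pos (by norm_num),
      Real.sqrt_eq_rpow]
    norm_num
  refine h1.trans ?_
  rw [integral_norm_eq_lintegral_enorm (Lp.aestronglyMeasurable φ), ← eLpNorm_one_eq_lintegral_enorm]
  refine (ENNReal.toReal_mono (ENNReal.mul_ne_top (Lp.eLpNorm_ne_top φ) ENNReal.ofReal_ne_top)
    h2).trans (le_of_eq ?_)
  rw [ENNReal.toReal_mul, ENNReal.toReal_ofReal (Real.sqrt_nonneg 2), mul_comm, Lp.norm_def]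

theorem memLp_truncFourierFun_Icc (c : ℝ) (φ : L2I) :
    MemLp (truncFourierFun c φ) 2 (volume.restrict (Icc (-1 : ℝ) 1)) :=
  MemLp.of_bound (truncFourierFun_continuous c φ).aestronglyMeasurable _
    (Eventually.of_forall (norm_truncFourierFun_le c φ))

/-- The operator `F_c : L²([-1,1]) → L²([-1,1])`, `φ ↦ F[φ](c ·)` restricted to `[-1,1]`. -/
noncomputable def truncFourier (c : ℝ) : L2I →L[ℂ] L2I :=
  LinearMap.mkContinuous
    { toFun := fun φ => (memLp_truncFourierFun_Icc c φ).toLp _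
      map_add' := by
        intro φ ψ
        rw [← MemLp.toLp_add]
        congr 1
        ext x
        simp only [Pi.add_apply, truncFourierFun]
        rw [← integral_add (truncFourier_integrand_integrable c φ x)
          (truncFourier_integrand_integrable c ψ x)]
        refine integral_congr_ae ?_
        filter_upwards [Lp.coeFn_add φ ψ] with b hb
        rw [hb, Pi.add_apply, mul_add]
      map_smul' := by
        intro r φ
        rw [RingHom.id_apply, ← MemLp.toLp_const_smul]
        congr 1
        ext x
        simp only [Pi.smul_apply, truncFourierFun, smul_eq_mul]
        rw [← integral_const_mul]
        refine integral_congr_ae ?_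
        filter_upwards [Lp.coeFn_smul r φ] with b hb
        rw [hb, Pi.smul_apply, smul_eq_mul]
        ring }
    2 (by
      intro φ
      have hb : ∀ᵐ x ∂(volume.restrict (Icc (-1 : ℝ) 1)),
          ‖((memLp_truncFourierFun_Icc c φ).toLp _ : L2I) x‖ ≤ Real.sqrt 2 * ‖φ‖ := by
        filter_upwards [(memLp_truncFourierFun_Icc c φ).coeFn_toLp] with x hx
        rw [hx]
        exact norm_truncFourierFun_le c φ x
      refine (Lp.norm_le_of_ae_bound (by positivity) hb).trans (le_of_eq ?_)
      have hv : (measureUnivNNReal (volume.restrict (Icc (-1 : ℝ) 1)) : ℝ) = 2 := by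
        have h2 : volume.restrict (Icc (-1 : ℝ) 1) univ = 2 := by
          rw [Measure.restrict_apply_univ, Real.volume_Icc]
          norm_num
        simp only [measureUnivNNReal, h2, ENNReal.coe_toNNReal_eq_toReal, ENNReal.toReal_ofNat]
      rw [hv, ← mul_assoc]
      congr 1
      rw [Real.sqrt_eq_rpow, ← Real.rpow_add (by norm_num)]
      norm_num)

/-- `(σ, φ, g)` is a singular value decomposition of `A`: the singular values `σ₀ ≥ σ₁ ≥ ⋯ > 0`
are listed in decreasing order (repeated according to multiplicity), `(φ_m)` and `(g_m)` are
orthonormal, `A φ_m = σ_m g_m`, `A^* g_m = σ_m φ_m`, and `A f = ∑_m σ_m ⟨f, φ_m⟩ g_m` for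
every `f`. -/
structure IsSingularSystem {H K : Type*} [NormedAddCommGroup H] [InnerProductSpace ℂ H]
    [CompleteSpace H] [NormedAddCommGroup K] [InnerProductSpace ℂ K] [CompleteSpace K]
    (A : H →L[ℂ] K) (σ : ℕ → ℝ) (φ : ℕ → H) (g : ℕ → K) : Prop where
  pos : ∀ m, 0 < σ m
  antitone : Antitone σ
  orthonormal_left : Orthonormal ℂ φ
  orthonormal_right : Orthonormal ℂ g
  map_eq : ∀ m, A (φ m) = (σ m : ℂ) • g m
  adjoint_eq : ∀ m, ContinuousLinearMap.adjoint A (g m) = (σ m : ℂ) • φ m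
  hasSum : ∀ f, HasSum (fun m => ((σ m : ℂ) * inner ℂ (φ m) f) • g m) (A f)

/-! ### Prolate spheroidal wave functions -/

/-- `ρ_m = |c| σ_m² / (2π)`, the eigenvalues of `(|c| / (2π)) F_c F_c^*`. -/
noncomputable def rho (c : ℝ) (σ : ℕ → ℝ) (m : ℕ) : ℝ :=
  |c| * σ m ^ 2 / (2 * Real.pi)

/-- The extension to `ℝ`, as an entire function, of the right singular function `g_m` of `F_c`:
`g_m(x) = σ_m⁻¹ ∫_{-1}^{1} exp(i c b x) φ_m(b) db`. -/
noncomputable def pswf (c : ℝ) (σ : ℕ → ℝ) (φ : ℕ → L2I) (m : ℕ) (x : ℝ) : ℂ :=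
  (σ m : ℂ)⁻¹ * truncFourierFun c (φ m) x

/-- `pswf` extends `g_m`. -/
theorem pswf_ae_eq (c : ℝ) {σ : ℕ → ℝ} {φ g : ℕ → L2I}
    (h : IsSingularSystem (truncFourier c) σ φ g) (m : ℕ) :
    pswf c σ φ m =ᵐ[volume.restrict (Icc (-1 : ℝ) 1)] g m := by
  have h1 : (truncFourier c (φ m) : L2I) =ᵐ[volume.restrict (Icc (-1 : ℝ) 1)]
      truncFourierFun c (φ m) := (memLp_truncFourierFun_Icc c (φ m)).coeFn_toLp
  have h2 := Lp.coeFn_smul (σ m : ℂ) (g m)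
  rw [← h.map_eq m] at h2
  have hσ : (σ m : ℂ) ≠ 0 := by exact_mod_cast (h.pos m).ne'
  filter_upwards [h1, h2] with x hx1 hx2
  rw [pswf, ← hx1, hx2, Pi.smul_apply, smul_eq_mul, inv_mul_cancel_left₀ hσ]

/-- For `f ∈ L¹(ℝ) ∩ L²(ℝ)` the Fourier integral coincides with the `L²` Fourier transform. -/
theorem fourier_ae_eq_fourier_toLp {f : ℝ → ℂ} (hf : Integrable f) (hf2 : MemLp f 2 volume) :
    𝓕 f =ᵐ[volume] (𝓕 (hf2.toLp f) : L2R) := by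
  have hc : Continuous (𝓕 f) :=
    VectorFourier.fourierIntegral_continuous Real.continuous_fourierChar
      (by exact continuous_inner) hf
  refine ae_eq_of_integral_contDiff_smul_eq hc.locallyIntegrable
    ((Lp.memLp _).locallyIntegrable (by norm_num)) ?_
  intro u hu hsu
  have hsu' : HasCompactSupport (Complex.ofRealCLM ∘ u) := hsu.comp_left rfl
  have hu' : ContDiff ℝ ∞ (Complex.ofRealCLM ∘ u) := by fun_prop
  set w : SchwartzMap ℝ ℂ := hsu'.toSchwartzMap hu' with hw
  have hwu : ∀ x, w x = (u x : ℂ) := fun x => rfl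
  have key := congrArg (fun T => T w) (Lp.fourier_toTemperedDistribution_eq (hf2.toLp f))
  simp only [TemperedDistribution.fourier_apply, Lp.toTemperedDistribution_apply] at key
  have e1 : ∫ x, u x • (𝓕 (hf2.toLp f) : L2R) x = ∫ x, w x • (𝓕 (hf2.toLp f) : L2R) x := by
    refine integral_congr_ae (Eventually.of_forall fun x => ?_)
    simp only [hwu, smul_eq_mul, Complex.real_smul]
  have e2 : ∫ x, u x • (𝓕 f) x = ∫ x, w x • (𝓕 f) x := by
    refine integral_congr_ae (Eventually.of_forall fun x => ?_)
    simp only [hwu, smul_eq_mul, Complex.real_smul]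
  rw [e1, e2, ← key]
  have e3 : ∫ x, (𝓕 w) x • (hf2.toLp f : L2R) x = ∫ x, (𝓕 (w : ℝ → ℂ)) x • f x := by
    refine integral_congr_ae ?_
    filter_upwards [hf2.coeFn_toLp] with x hx
    rw [hx, SchwartzMap.fourier_coe]
  rw [e3]
  have := VectorFourier.integral_fourierIntegral_smul_eq_flip (μ := volume) (ν := volume)
    (L := innerₗ ℝ) Real.continuous_fourierChar (by exact continuous_inner)
    (w.integrable) hf
  rw [flip_innerₗ] at this
  exact this.symm

theorem memLp_truncFourierFun {c : ℝ} (hc : c ≠ 0) (φ : L2I) :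
    MemLp (truncFourierFun c φ) 2 volume := by
  set f : ℝ → ℂ := (Icc (-1 : ℝ) 1).indicator φ with hf
  have hf1 : Integrable f := (integrable_indicator_iff measurableSet_Icc).2 (L2I_integrable φ)
  have hf2 : MemLp f 2 volume :=
    (memLp_indicator_iff_restrict measurableSet_Icc).2 (Lp.memLp φ)
  have h1 : MemLp (𝓕 f) 2 volume :=
    (memLp_congr_ae (fourier_ae_eq_fourier_toLp hf1 hf2)).2 (Lp.memLp _)
  have hk : (-(c / (2 * Real.pi)) : ℝ) ≠ 0 := by
    simp [hc, Real.pi_ne_zero]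
  have h2 : truncFourierFun c φ = fun x => 𝓕 f (-(c / (2 * Real.pi)) * x) := by
    ext x
    rw [Real.fourier_real_eq_integral_exp_smul, truncFourierFun, ← integral_indicator
      measurableSet_Icc]
    refine integral_congr_ae (Eventually.of_forall fun b => ?_)
    simp only [hf, indicator]
    split_ifs
    · rw [smul_eq_mul]
      congr 2
      push_cast
      have : (Real.pi : ℂ) ≠ 0 := by exact_mod_cast Real.pi_ne_zero
      field_simp
    · simp
  rw [h2]
  have hmap : Measure.map (fun x : ℝ => -(c / (2 * Real.pi)) * x) volume
      = ENNReal.ofReal |(-(c / (2 * Real.pi)))⁻¹| • (volume : Measure ℝ) :=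
    Real.map_volume_mul_left hk
  have h3 : MemLp (𝓕 f) 2 (Measure.map (fun x : ℝ => -(c / (2 * Real.pi)) * x) volume) := by
    rw [hmap]
    exact h1.smul_measure ENNReal.ofReal_ne_top
  exact h3.comp_of_map (by fun_prop)

theorem memLp_pswf_dilated {c ε : ℝ} (hc : c ≠ 0) (hε : ε ≠ 0) (σ : ℕ → ℝ) (φ : ℕ → L2I)
    (m : ℕ) : MemLp (fun x : ℝ => pswf c σ φ m (x / ε)) 2 volume := by
  have h1 : MemLp (pswf c σ φ m) 2 volume := (memLp_truncFourierFun hc (φ m)).const_mul _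
  have hmap : Measure.map (fun x : ℝ => ε⁻¹ * x) volume
      = ENNReal.ofReal |(ε⁻¹)⁻¹| • (volume : Measure ℝ) :=
    Real.map_volume_mul_left (inv_ne_zero hε)
  have h3 : MemLp (pswf c σ φ m) 2 (Measure.map (fun x : ℝ => ε⁻¹ * x) volume) := by
    rw [hmap]
    exact h1.smul_measure ENNReal.ofReal_ne_top
  have h4 := h3.comp_of_map (by fun_prop)
  have h5 : (fun x : ℝ => pswf c σ φ m (x / ε)) = pswf c σ φ m ∘ fun x : ℝ => ε⁻¹ * x := by
    ext x
    rw [Function.comp_apply, div_eq_inv_mul]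
  rw [h5]
  exact h4

/-- The function `g_m(· / ε)`, where `c = a ε`, as an element of `L²(ℝ)`. -/
noncomputable def pswfDilated {a ε : ℝ} (ha : 0 < a) (hε : 0 < ε) (σ : ℕ → ℝ) (φ : ℕ → L2I)
    (m : ℕ) : L2R :=
  (memLp_pswf_dilated (mul_pos ha hε).ne' hε.ne' σ φ m).toLp _

/-! ### The interpolation operator -/

/-- The inner product `⟨h, g_m(· / ε)⟩` in `L²(ℝ \ (-ε,ε))`, where `c = a ε`. -/
noncomputable def outerCoeff (a ε : ℝ) (σ : ℕ → ℝ) (φ : ℕ → L2I) (h : L2R) (m : ℕ) : ℂ :=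
  ∫ x in (Ioo (-ε) ε)ᶜ, h x * conj (pswf (a * ε) σ φ m (x / ε))

/-- The `m`-th term `ρ_m ⟨h, g_m(·/ε)⟩_{L²(ℝ \ (-ε,ε))} / ((1 - ρ_m) ε) · g_m(·/ε)` of the
interpolation series. -/
noncomputable def interpTerm {a ε : ℝ} (ha : 0 < a) (hε : 0 < ε) (σ : ℕ → ℝ) (φ : ℕ → L2I)
    (h : L2R) (m : ℕ) : L2R :=
  (((rho (a * ε) σ m : ℝ) : ℂ) * outerCoeff a ε σ φ h m /
    (((1 - rho (a * ε) σ m) * ε : ℝ) : ℂ)) • pswfDilated ha hε σ φ m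

/-- The interpolation operator `I_{a,ε}`, the sum of the interpolation series. -/
noncomputable def interp {a ε : ℝ} (ha : 0 < a) (hε : 0 < ε) (σ : ℕ → ℝ) (φ : ℕ → L2I)
    (h : L2R) : L2R :=
  ∑' m, interpTerm ha hε σ φ h m

/-- `C₀(c) = 4 c / (π (1 - ρ₀)²)`. -/
noncomputable def C0 (c : ℝ) (σ : ℕ → ℝ) : ℝ :=
  4 * c / (Real.pi * (1 - rho c σ 0) ^ 2)

/-- The restriction map `L²(ℝ) → L²([-ε,ε])`. -/
noncomputable def restrictIcc (ε : ℝ) :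
    L2R →L[ℂ] Lp ℂ 2 ((volume : Measure ℝ).restrict (Icc (-ε) ε)) :=
  LpToLpRestrictCLM ℝ ℂ ℂ volume 2 (Icc (-ε) ε)

end PSWF

/-! Write `S φ (x) = ∫_{-1}^{1} exp(i a b x) φ(b) db` for the synthesis map `L²([-1,1]) → L²(ℝ)` and
`G_m = g_m(· / ε)`. Since `c = a ε`, one has `G_m = σ_m⁻¹ S φ_m`. By Plancherel `S` multiplies inner
products by `2π / a`, while the inner product of `S φ` and `S ψ` over `[-ε,ε]` is `ε` times that of
`F_c φ` and `F_c ψ`. Hence the `G_m` are orthogonal on the line, with squared norm `2π / (a σ_m²) =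
ε / ρ_m`, and on `[-ε,ε]`, with squared norm `ε`. By subtraction they are orthogonal on the outer
region, with squared norm `τ_m = (1 - ρ_m) ε / ρ_m` (`inner_restrictOuter_pswfDilated`).

The weight in the interpolation series is therefore `1 / τ_m`: the series has the coefficients of
the orthogonal expansion of `h` on the outer region, but is summed on the whole line. Analyticity
gives `τ_m > 0`, that is `ρ_m < 1`. Bessel's inequality outside, with the norm ratios `1 / (1 -
ρ_m)` (line to outside) and `ρ_m / (1 - ρ_m)` (inside to outside), both largest at `m = 0`, gives
convergence and the bound `norm_sq_restrictIcc_interp_le`.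

Each element of `PW(a)` is some `S ψ`, and injectivity of `F_c` makes `(φ_m)` complete, so the
series reproduces `PW(a)`. With `p = P_a f` the estimate follows from `f - I[h] = (f - p) + I[p -
h]`.

A singular system exists because `F_c` is compact and injective on an infinite-dimensional space; it
is built by maximising `‖A v‖` successively over orthogonal complements. -/

namespace PSWF

/-! ### Orthonormal series -/

section Orthonormal

variable {ι H : Type*} [NormedAddCommGroup H] [InnerProductSpace ℂ H]

theorem norm_sq_sum_smul {v : ι → H} (hv : Orthonormal ℂ v) (a : ι → ℂ) (s : Finset ι) :
    ‖∑ i ∈ s, a i • v i‖ ^ 2 = ∑ i ∈ s, ‖a i‖ ^ 2 := by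
  have := hv.orthogonalFamily.norm_sum a s
  simpa using this

theorem hasSum_norm_sq {v : ι → H} (hv : Orthonormal ℂ v) {a : ι → ℂ} {x : H}
    (h : HasSum (fun i => a i • v i) x) : HasSum (fun i => ‖a i‖ ^ 2) (‖x‖ ^ 2) := by
  have := (continuous_norm.pow 2).continuousAt.tendsto.comp (show Tendsto _ _ _ from h)
  refine Tendsto.congr (fun s => ?_) this
  exact norm_sq_sum_smul hv a s

theorem summable_smul_of_summable_norm_sq [CompleteSpace H] {v : ι → H} (hv : Orthonormal ℂ v)
    {a : ι → ℂ} (h : Summable fun i => ‖a i‖ ^ 2) : Summable fun i => a i • v i := by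
  have := (hv.orthogonalFamily.summable_iff_norm_sq_summable a).2 h
  simpa using this

end Orthonormal

/-! ### Singular value decomposition of compact operators -/

section SVD

/-- The decreasing norms have a limit `L`. If `L > 0`, orthogonal images are more than `L` apart, so
no subsequence of them is Cauchy, against compactness. -/
theorem tendsto_norm_map_zero_of_orthogonal {H K : Type*} [NormedAddCommGroup H]
    [InnerProductSpace ℂ H] [NormedAddCommGroup K] [InnerProductSpace ℂ K] {A : H →L[ℂ] K}
    (hA : IsCompactOperator A)
    {φ : ℕ → H} (hφ : ∀ n, ‖φ n‖ = 1) (ho : ∀ m n, m ≠ n → inner ℂ (A (φ m)) (A (φ n)) = 0)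
    (hanti : Antitone fun n => ‖A (φ n)‖) : Tendsto (fun n => ‖A (φ n)‖) atTop (nhds 0) := by
  have hbdd : BddBelow (range fun n => ‖A (φ n)‖) := ⟨0, by rintro _ ⟨n, rfl⟩; exact norm_nonneg _⟩
  have hlim := tendsto_atTop_ciInf hanti hbdd
  set L := ⨅ n, ‖A (φ n)‖ with hL
  have hL0 : 0 ≤ L := le_ciInf fun n => norm_nonneg _
  have hLle : ∀ n, L ≤ ‖A (φ n)‖ := fun n => ciInf_le hbdd n
  rcases hL0.eq_or_lt with h | h
  · rwa [← h] at hlim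
  exfalso
  obtain ⟨S, hS, hSsub⟩ := hA.image_closedBall_subset_compact 1
  have hmem : ∀ n, A (φ n) ∈ S := fun n => hSsub ⟨φ n, by simp [hφ], rfl⟩
  obtain ⟨y, -, ψ, hψ, hy⟩ := hS.tendsto_subseq hmem
  obtain ⟨N, hN⟩ := Metric.cauchySeq_iff'.1 hy.cauchySeq L h
  have h1 := hN (N + 1) (Nat.le_succ N)
  have hne : ψ (N + 1) ≠ ψ N := fun h => by simpa using hψ.injective h
  have h2 := norm_sub_sq (𝕜 := ℂ) (A (φ (ψ (N + 1)))) (A (φ (ψ N)))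
  rw [ho _ _ hne] at h2
  simp only [map_zero, mul_zero, sub_zero, Function.comp_apply, dist_eq_norm] at h1 h2
  have h3 := pow_lt_pow_left₀ h1 (norm_nonneg _) two_ne_zero
  rw [h2] at h3
  have h4 := pow_le_pow_left₀ hL0 (hLle (ψ (N + 1))) 2
  nlinarith [sq_nonneg ‖A (φ (ψ N))‖]
variable {H K : Type*} [NormedAddCommGroup H] [InnerProductSpace ℂ H] [CompleteSpace H]
  [NormedAddCommGroup K] [InnerProductSpace ℂ K] [CompleteSpace K]

open ContinuousLinearMap (adjoint)

theorem norm_sq_map_of_adjoint_map_eq (A : H →L[ℂ] K) {v : H} {r : ℝ}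
    (h : adjoint A (A v) = (r : ℂ) • v) : ‖A v‖ ^ 2 = r * ‖v‖ ^ 2 := by
  have h1 : inner ℂ v (adjoint A (A v)) = inner ℂ (A v) (A v) :=
    ContinuousLinearMap.adjoint_inner_right A v (A v)
  rw [h, inner_smul_right, inner_self_eq_norm_sq_to_K, inner_self_eq_norm_sq_to_K] at h1
  have h2 : ((‖A v‖ ^ 2 : ℝ) : ℂ) = ((r * ‖v‖ ^ 2 : ℝ) : ℂ) := by
    push_cast
    exact h1.symm
  exact Complex.ofReal_injective h2

/-- A nonzero compact operator attains its norm. -/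
theorem exists_adjoint_map_eq_norm_sq_smul {B : H →L[ℂ] K} (hB : IsCompactOperator B)
    (h0 : B ≠ 0) : ∃ v, ‖v‖ = 1 ∧ adjoint B (B v) = ((‖B‖ ^ 2 : ℝ) : ℂ) • v := by
  set T : H →L[ℂ] H := adjoint B ∘L B with hT
  have hn : ‖T‖ = ‖B‖ ^ 2 := by
    rw [hT, ContinuousLinearMap.norm_adjoint_comp_self, sq]
  have hBn : 0 < ‖B‖ := norm_pos_iff.2 h0
  have hTc : IsCompactOperator T := hB.clm_comp (adjoint B)
  have hne : Nontrivial H := by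
    by_contra hh
    rw [not_nontrivial_iff_subsingleton] at hh
    exact h0 (Subsingleton.elim _ _)
  have hTn : (((‖T‖ : ℝ) : ℂ)) ≠ 0 := by
    rw [hn]; exact_mod_cast (pow_pos hBn 2).ne'
  -- Fredholm alternative for the compact operator `B^* B` at the nonzero value `‖B^* B‖`.
  rcases hTc.hasEigenvalue_or_mem_resolventSet hTn with h | h
  · obtain ⟨v, hv⟩ := h.exists_hasEigenvector
    have hv1 : T v = ((‖T‖ : ℝ) : ℂ) • v := hv.apply_eq_smul
    have hv0 : (‖v‖ : ℂ) ≠ 0 := by exact_mod_cast (norm_pos_iff.2 hv.2).ne'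
    refine ⟨(‖v‖ : ℂ)⁻¹ • v, norm_smul_inv_norm hv.2, ?_⟩
    rw [← hn, map_smul, map_smul, smul_comm, ← hv1]
    rfl
  · exfalso
    -- In the resolvent case the Rayleigh quotient `‖B x‖² / ‖x‖²` stays below `‖B‖²` by a fixed `e
    -- > 0`, which contradicts the definition of `‖B‖`.
    obtain ⟨e, he, hle⟩ := T.rayleighQuotient_le_of_norm_mem_resolventSet h
    have hb : ∀ x, ‖B x‖ ^ 2 ≤ (‖B‖ ^ 2 - e) * ‖x‖ ^ 2 := by
      intro x
      by_cases hx : x = 0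
      · simp [hx]
      have h1 := hle x
      have hx' : 0 < ‖x‖ ^ 2 := pow_pos (norm_pos_iff.2 hx) 2
      rw [ContinuousLinearMap.rayleighQuotient, div_le_iff₀ hx', hn] at h1
      refine le_trans (le_of_eq ?_) h1
      rw [ContinuousLinearMap.reApplyInnerSelf_apply, hT, ContinuousLinearMap.comp_apply,
        ContinuousLinearMap.adjoint_inner_left, inner_self_eq_norm_sq]
    obtain ⟨x, hx⟩ := exists_ne (0 : H)
    have hx' : 0 < ‖x‖ ^ 2 := pow_pos (norm_pos_iff.2 hx) 2
    have hpos : 0 ≤ ‖B‖ ^ 2 - e := by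
      have := (sq_nonneg ‖B x‖).trans (hb x)
      exact nonneg_of_mul_nonneg_left this hx'
    have h2 : ‖B‖ ≤ Real.sqrt (‖B‖ ^ 2 - e) := by
      refine B.opNorm_le_bound (Real.sqrt_nonneg _) fun x => ?_
      refine abs_le_of_sq_le_sq' ?_ (by positivity) |>.2
      rw [mul_pow, Real.sq_sqrt hpos]
      exact hb x
    have h3 := pow_le_pow_left₀ hBn.le h2 2
    rw [Real.sq_sqrt hpos] at h3
    linarith

/-- On the orthogonal complement of an invariant subspace of `A^* A`, a compact injective operator
attains its norm at an eigenvector of `A^* A`. -/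
theorem exists_singular_vector {A : H →L[ℂ] K} (hA : IsCompactOperator A)
    (hinj : Function.Injective A) (hdim : ¬ FiniteDimensional ℂ H) (V : Submodule ℂ H)
    [FiniteDimensional ℂ V] (hV : ∀ x ∈ V, adjoint A (A x) ∈ V) :
    ∃ v s, v ∈ Vᗮ ∧ ‖v‖ = 1 ∧ 0 < s ∧ adjoint A (A v) = ((s ^ 2 : ℝ) : ℂ) • v ∧
      ∀ w ∈ Vᗮ, ‖A w‖ ≤ s * ‖w‖ := by
  set B : Vᗮ →L[ℂ] K := A ∘L Vᗮ.subtypeL with hBdef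
  have hB : IsCompactOperator B := hA.comp_clm _
  have hVo : Vᗮ ≠ ⊥ := by
    intro h
    rw [Submodule.orthogonal_eq_bot_iff] at h
    subst h
    exact hdim (Submodule.topEquiv (R := ℂ) (M := H)).finiteDimensional
  obtain ⟨x, hxV, hx0⟩ := Submodule.exists_mem_ne_zero_of_ne_bot hVo
  have hB0 : B ≠ 0 := by
    intro h
    have h1 : B ⟨x, hxV⟩ = 0 := by rw [h]; rfl
    exact hx0 (hinj (h1.trans (map_zero A).symm))
  obtain ⟨v, hv, hvB⟩ := exists_adjoint_map_eq_norm_sq_smul hB hB0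
  refine ⟨v, ‖B‖, v.2, hv, norm_pos_iff (a := B) |>.2 hB0, ?_, fun w hw => B.le_opNorm ⟨w, hw⟩⟩
  have hmem : adjoint A (A v) ∈ Vᗮ := by
    intro u hu
    rw [ContinuousLinearMap.adjoint_inner_right, ← ContinuousLinearMap.adjoint_inner_left]
    exact v.2 _ (hV u hu)
  -- The eigenvector equation for `B^* B` only controls inner products with `Vᗮ`. Since `A^* A`
  -- preserves `Vᗮ` (`hmem`), the defect is in `Vᗮ` and orthogonal to it, hence zero.
  have hinner : ∀ w ∈ Vᗮ, inner ℂ w (adjoint A (A v) - ((‖B‖ ^ 2 : ℝ) : ℂ) • (v : H)) = 0 := by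
    intro w hw
    have h1 : inner ℂ (⟨w, hw⟩ : Vᗮ) (adjoint B (B v)) = inner ℂ (A w) (A v) :=
      ContinuousLinearMap.adjoint_inner_right B ⟨w, hw⟩ (B v)
    rw [hvB, ← ContinuousLinearMap.adjoint_inner_right] at h1
    rw [inner_sub_right, ← h1]
    exact sub_self _
  have := hinner _ (Vᗮ.sub_mem hmem (Vᗮ.smul_mem ((‖B‖ ^ 2 : ℝ) : ℂ) v.2))
  exact sub_eq_zero.1 (inner_self_eq_zero.1 this)

/-- A compact injective operator on an infinite-dimensional Hilbert space has a singular value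
decomposition. -/
theorem exists_isSingularSystem {A : H →L[ℂ] K} (hA : IsCompactOperator A)
    (hinj : Function.Injective A) (hdim : ¬ FiniteDimensional ℂ H) :
    ∃ σ φ g, IsSingularSystem A σ φ g := by
  -- The recursion carries finite dimension and `A^* A`-invariance along with each subspace, as both
  -- are needed for the next maximisation.
  let S := {V : Submodule ℂ H // FiniteDimensional ℂ V ∧ ∀ x ∈ V, adjoint A (A x) ∈ V}
  have hstep : ∀ V : S, ∃ v s, v ∈ (V : Submodule ℂ H)ᗮ ∧ ‖v‖ = 1 ∧ 0 < s ∧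
      adjoint A (A v) = ((s ^ 2 : ℝ) : ℂ) • v ∧
      ∀ w ∈ (V : Submodule ℂ H)ᗮ, ‖A w‖ ≤ s * ‖w‖ := by
    rintro ⟨V, hV1, hV2⟩
    exact exists_singular_vector hA hinj hdim V hV2
  choose v s hvV hv1 hs hvs hmax using hstep
  let next : S → S := fun V => ⟨(V : Submodule ℂ H) ⊔ Submodule.span ℂ {v V}, by
    have := V.2.1
    exact Submodule.finiteDimensional_sup _ _, by
    intro x hx
    obtain ⟨y, hy, z, hz, rfl⟩ := Submodule.mem_sup.1 hx
    obtain ⟨r, rfl⟩ := Submodule.mem_span_singleton.1 hz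
    rw [map_add, map_add]
    refine Submodule.add_mem_sup (V.2.2 y hy) (Submodule.mem_span_singleton.2 ⟨r * ((s V ^ 2 : ℝ) : ℂ), ?_⟩)
    rw [map_smul, map_smul, hvs, smul_smul]⟩
  let V : ℕ → S := fun n => Nat.rec ⟨⊥, inferInstance, by simp⟩ (fun _ W => next W) n
  have hVs : ∀ n, (V (n + 1) : Submodule ℂ H) = (V n).1 ⊔ Submodule.span ℂ {v (V n)} := fun n => rfl
  have hVmono : Monotone fun n => (V n).1 := monotone_nat_of_le_succ fun n => by
    simp only [hVs]
    exact le_sup_left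
  set φ : ℕ → H := fun n => v (V n) with hφ
  set σ : ℕ → ℝ := fun n => s (V n) with hσ
  have hφmem : ∀ m n, m < n → φ m ∈ (V n).1 := by
    intro m n hmn
    refine hVmono (Nat.succ_le_of_lt hmn) ?_
    simp only [Nat.succ_eq_add_one, hVs]
    exact Submodule.mem_sup_right (Submodule.mem_span_singleton_self _)
  have hlt : ∀ m n, m < n → inner ℂ (φ m) (φ n) = 0 := fun m n hmn =>
    hvV (V n) _ (hφmem m n hmn)
  have horth : Orthonormal ℂ φ := by
    refine ⟨fun n => hv1 _, fun m n hmn => ?_⟩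
    rcases lt_or_gt_of_ne hmn with h | h
    · exact hlt m n h
    · exact inner_eq_zero_symm.1 (hlt n m h)
  have hσpos : ∀ n, 0 < σ n := fun n => hs _
  have hσne : ∀ n, (σ n : ℂ) ≠ 0 := fun n => by exact_mod_cast (hσpos n).ne'
  have heig : ∀ n, adjoint A (A (φ n)) = ((σ n ^ 2 : ℝ) : ℂ) • φ n := fun n => hvs _
  have hnorm : ∀ n, ‖A (φ n)‖ = σ n := by
    intro n
    have := norm_sq_map_of_adjoint_map_eq A (heig n)
    rw [show ‖φ n‖ = 1 from hv1 _, one_pow, mul_one] at this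
    exact (sq_eq_sq₀ (norm_nonneg _) (hσpos n).le).1 this
  -- The complements shrink, so `φ (n + 1)` already competed in the maximisation at stage `n`.
  have hanti : Antitone σ := antitone_nat_of_succ_le fun n => by
    have h1 : φ (n + 1) ∈ (V n).1ᗮ :=
      Submodule.orthogonal_le (hVmono (Nat.le_succ n)) (hvV (V (n + 1)))
    have h2 : ‖A (φ (n + 1))‖ ≤ σ n * ‖φ (n + 1)‖ := hmax (V n) _ h1
    have h3 : ‖φ (n + 1)‖ = 1 := hv1 _
    calc σ (n + 1) = ‖A (φ (n + 1))‖ := (hnorm (n + 1)).symm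
      _ ≤ σ n * ‖φ (n + 1)‖ := h2
      _ = σ n := by rw [h3, mul_one]
  have hinner : ∀ m n, inner ℂ (A (φ m)) (A (φ n)) = ((σ n ^ 2 : ℝ) : ℂ) * inner ℂ (φ m) (φ n) := by
    intro m n
    rw [← ContinuousLinearMap.adjoint_inner_right, heig, inner_smul_right]
  have hσ0 : Tendsto σ atTop (nhds 0) := by
    have := tendsto_norm_map_zero_of_orthogonal hA (φ := φ) (fun n => hv1 _)
      (fun m n hmn => by rw [hinner, horth.2 hmn, mul_zero]) (by simpa only [hnorm] using hanti)
    simpa only [hnorm] using this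
  set g : ℕ → K := fun n => (σ n : ℂ)⁻¹ • A (φ n) with hg
  have hmap : ∀ m, A (φ m) = (σ m : ℂ) • g m := fun m => by
    rw [hg]; exact (smul_inv_smul₀ (hσne m) _).symm
  have hgorth : Orthonormal ℂ g := by
    refine ⟨fun n => ?_, fun m n hmn => ?_⟩
    · rw [hg]
      simp only
      rw [norm_smul, hnorm, norm_inv, Complex.norm_real, Real.norm_of_nonneg (hσpos n).le,
        inv_mul_cancel₀ (hσpos n).ne']
    · simp only [hg, inner_smul_left, inner_smul_right, hinner, horth.2 hmn, mul_zero]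
  refine ⟨σ, φ, g, hσpos, hanti, horth, hgorth, hmap, fun m => ?_, fun f => ?_⟩
  · rw [hg]
    simp only
    rw [map_smul, heig, smul_smul]
    congr 1
    have := hσne m
    push_cast
    field_simp
  · have hsum : Summable fun m => ((σ m : ℂ) * inner ℂ (φ m) f) • g m := by
      refine summable_smul_of_summable_norm_sq hgorth ?_
      refine Summable.of_nonneg_of_le (fun m => by positivity) (fun m => ?_)
        ((horth.inner_products_summable f).mul_left (σ 0 ^ 2))
      rw [norm_mul, mul_pow, Complex.norm_real, Real.norm_of_nonneg (hσpos m).le]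
      gcongr
      · exact (hσpos m).le
      · exact hanti (Nat.zero_le m)
    -- The remainder lies in the complement of `V n`, where `‖A w‖ ≤ σ n * ‖w‖`. As `σ n → 0`, this
    -- identifies the sum along ranges as `A f`; the unconditional convergence is `hsum`.
    set r : ℕ → H := fun n => f - ∑ i ∈ Finset.range n, inner ℂ (φ i) f • φ i with hr
    have hrmem : ∀ n, r n ∈ (V n).1ᗮ := by
      intro n
      induction n with
      | zero =>
        change r 0 ∈ (⊥ : Submodule ℂ H)ᗮ
        simp
      | succ n ih =>
        have hrs : r (n + 1) = r n - inner ℂ (φ n) f • φ n := by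
          simp only [hr, Finset.sum_range_succ]; abel
        rw [hVs, ← Submodule.inf_orthogonal]
        refine ⟨?_, ?_⟩
        · rw [hrs]
          exact Submodule.sub_mem _ ih (Submodule.smul_mem _ _ (hvV (V n)))
        · refine Submodule.mem_orthogonal_singleton_iff_inner_right.2 ?_
          change inner ℂ (φ n) (r (n + 1)) = 0
          rw [hr]
          simp only
          rw [inner_sub_right, horth.inner_right_sum _ (Finset.self_mem_range_succ n), sub_self]
    have hrnorm : ∀ n, ‖r n‖ ≤ ‖f‖ := by
      intro n
      have h1 : inner ℂ (∑ i ∈ Finset.range n, inner ℂ (φ i) f • φ i) (r n) = 0 :=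
        hrmem n _ (Submodule.sum_mem _ fun i hi =>
          Submodule.smul_mem _ _ (hφmem i n (Finset.mem_range.1 hi)))
      have h2 := norm_add_sq_eq_norm_sq_add_norm_sq_of_inner_eq_zero _ _ h1
      rw [hr] at h2 ⊢
      simp only [add_sub_cancel] at h2 ⊢
      nlinarith [norm_nonneg f, norm_nonneg (∑ i ∈ Finset.range n, inner ℂ (φ i) f • φ i),
        norm_nonneg (f - ∑ i ∈ Finset.range n, inner ℂ (φ i) f • φ i)]
    have hlim : Tendsto (fun n => ∑ i ∈ Finset.range n, ((σ i : ℂ) * inner ℂ (φ i) f) • g i) atTop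
        (nhds (A f)) := by
      rw [tendsto_iff_norm_sub_tendsto_zero]
      refine squeeze_zero (fun n => norm_nonneg _) (fun n => ?_) (by simpa using hσ0.mul_const ‖f‖)
      have : ∑ i ∈ Finset.range n, ((σ i : ℂ) * inner ℂ (φ i) f) • g i - A f = - A (r n) := by
        rw [hr]
        simp only [map_sub, map_sum, map_smul, hmap, smul_smul, neg_sub]
        congr 1
        exact Finset.sum_congr rfl fun i _ => by rw [mul_comm]
      rw [this, norm_neg]
      refine (hmax (V n) _ (hrmem n)).trans ?_
      exact mul_le_mul_of_nonneg_left (hrnorm n) (hσpos n).le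
    have := tendsto_nhds_unique hlim hsum.hasSum.tendsto_sum_nat
    rw [this]
    exact hsum.hasSum

end SVD

/-! ### Linearity and analyticity of the truncated Fourier integral -/

theorem truncFourierFun_add (c : ℝ) (φ ψ : L2I) (x : ℝ) :
    truncFourierFun c (φ + ψ) x = truncFourierFun c φ x + truncFourierFun c ψ x := by
  simp only [truncFourierFun]
  rw [← integral_add (truncFourier_integrand_integrable c φ x)
    (truncFourier_integrand_integrable c ψ x)]
  refine integral_congr_ae ?_
  filter_upwards [Lp.coeFn_add φ ψ] with b hb
  rw [hb, Pi.add_apply, mul_add]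

theorem truncFourierFun_smul (c : ℝ) (r : ℂ) (φ : L2I) (x : ℝ) :
    truncFourierFun c (r • φ) x = r * truncFourierFun c φ x := by
  simp only [truncFourierFun]
  rw [← integral_const_mul]
  refine integral_congr_ae ?_
  filter_upwards [Lp.coeFn_smul r φ] with b hb
  rw [hb, Pi.smul_apply, smul_eq_mul]
  ring

theorem truncFourierFun_mul_scale (a ε : ℝ) (φ : L2I) (x : ℝ) :
    truncFourierFun (a * ε) φ x = truncFourierFun a φ (ε * x) := by
  simp only [truncFourierFun]
  congr 1
  ext b
  congr 4
  ring

/-- Differentiation under the integral: as `b` stays in `[-1,1]`, the exponential and its derivative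
are bounded uniformly for `z` in a unit ball. -/
theorem differentiable_truncFourier_extension (c : ℝ) (φ : L2I) :
    Differentiable ℂ fun z : ℂ => ∫ b in Icc (-1 : ℝ) 1, Complex.exp (Complex.I * c * b * z) * φ b := by
  intro z₀
  have hnorm : ∀ b : ℝ, b ∈ Icc (-1 : ℝ) 1 → ∀ z : ℂ, z ∈ Metric.ball z₀ 1 →
      ‖Complex.exp (Complex.I * c * b * z)‖ ≤ Real.exp (|c| * (‖z₀‖ + 1)) := by
    intro b hb z hz
    rw [Complex.norm_exp]
    refine Real.exp_le_exp.2 ((Complex.re_le_norm _).trans ?_)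
    have hb' : |b| ≤ 1 := abs_le.2 hb
    have hz' : ‖z‖ ≤ ‖z₀‖ + 1 := by
      have h1 := norm_le_norm_add_norm_sub' z z₀
      have h2 : ‖z - z₀‖ < 1 := by simpa [dist_eq_norm] using hz
      linarith
    simp only [norm_mul, Complex.norm_I, one_mul, Complex.norm_real, Real.norm_eq_abs]
    calc |c| * |b| * ‖z‖ ≤ |c| * 1 * (‖z₀‖ + 1) := by gcongr
      _ = |c| * (‖z₀‖ + 1) := by ring
  have hmeas : AEStronglyMeasurable φ (volume.restrict (Icc (-1 : ℝ) 1)) :=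
    Lp.aestronglyMeasurable φ
  have hae : ∀ᵐ b ∂(volume.restrict (Icc (-1 : ℝ) 1)), b ∈ Icc (-1 : ℝ) 1 :=
    ae_restrict_mem measurableSet_Icc
  refine (hasDerivAt_integral_of_dominated_loc_of_deriv_le (s := Metric.ball z₀ 1)
    (F' := fun z (b : ℝ) => (Complex.I * c * b) * Complex.exp (Complex.I * c * b * z) * φ b)
    (bound := fun b => |c| * Real.exp (|c| * (‖z₀‖ + 1)) * ‖φ b‖)
    (Metric.ball_mem_nhds _ one_pos) ?_ ?_ ?_ ?_ ?_ ?_).2.differentiableAt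
  · refine Eventually.of_forall fun z => AEStronglyMeasurable.mul ?_ hmeas
    exact (by fun_prop : Continuous _).aestronglyMeasurable
  · refine (L2I_integrable φ).bdd_mul (c := Real.exp (|c| * (‖z₀‖ + 1)))
      (by fun_prop : Continuous _).aestronglyMeasurable ?_
    filter_upwards [hae] with b hb
    exact hnorm b hb z₀ (Metric.mem_ball_self one_pos)
  · exact ((by fun_prop : Continuous _).aestronglyMeasurable).mul hmeas
  · filter_upwards [hae] with b hb z hz
    have hb' : |b| ≤ 1 := abs_le.2 hb
    have h1 := hnorm b hb z hz
    rw [norm_mul, norm_mul]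
    gcongr
    simp only [norm_mul, Complex.norm_I, one_mul, Complex.norm_real, Real.norm_eq_abs]
    exact mul_le_of_le_one_right (abs_nonneg c) hb'
  · exact (L2I_integrable φ).norm.const_mul _
  · refine Eventually.of_forall fun b z _ => ?_
    have h1 : HasDerivAt (fun z : ℂ => Complex.I * c * b * z) (Complex.I * c * b) z := by
      simpa using (hasDerivAt_id z).const_mul (Complex.I * c * b)
    have h2 := (h1.cexp).mul_const (φ b)
    rwa [mul_comm (Complex.exp _) (Complex.I * c * b)] at h2

/-- A truncated Fourier integral that vanishes on an interval vanishes identically. -/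
theorem truncFourierFun_eq_zero_of_Ioo (c : ℝ) (φ : L2I) {l r : ℝ} (hlr : l < r)
    (h : ∀ x ∈ Ioo l r, truncFourierFun c φ x = 0) (x : ℝ) : truncFourierFun c φ x = 0 := by
  set G : ℂ → ℂ := fun z => ∫ b in Icc (-1 : ℝ) 1, Complex.exp (Complex.I * c * b * z) * φ b
    with hG
  have hGx : ∀ x : ℝ, G x = truncFourierFun c φ x := by
    intro x
    simp only [hG, truncFourierFun]
    congr 1
    ext b
    congr 2
    push_cast
    ring
  have han : AnalyticOnNhd ℂ G univ := fun z _ =>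
    (differentiable_truncFourier_extension c φ).analyticAt z
  obtain ⟨x₀, hx₀⟩ := exists_between hlr
  -- The identity theorem only needs zeros accumulating at one point, here `x₀` approached along the
  -- real axis.
  have hfreq : ∃ᶠ z in nhdsWithin (x₀ : ℂ) {(x₀ : ℂ)}ᶜ, G z = 0 := by
    have ht : Tendsto (fun x : ℝ => (x : ℂ)) (nhdsWithin x₀ {x₀}ᶜ)
        (nhdsWithin (x₀ : ℂ) {(x₀ : ℂ)}ᶜ) := by
      refine tendsto_nhdsWithin_iff.2 ⟨?_, ?_⟩
      · exact (Complex.continuous_ofReal.tendsto x₀).mono_left nhdsWithin_le_nhds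
      · filter_upwards [self_mem_nhdsWithin] with y hy
        simpa using hy
    refine ht.frequently (Eventually.frequently ?_)
    filter_upwards [nhdsWithin_le_nhds (Ioo_mem_nhds hx₀.1 hx₀.2)] with y hy
    rw [hGx, h y hy]
  have := han.eqOn_zero_of_preconnected_of_frequently_eq_zero isPreconnected_univ (mem_univ _) hfreq
  rw [← hGx]
  exact this (mem_univ _)

theorem truncFourierFun_eq_zero_of_ae_Ioo (c : ℝ) (φ : L2I) {l r : ℝ} (hlr : l < r)
    (h : ∀ᵐ x ∂(volume.restrict (Ioo l r)), truncFourierFun c φ x = 0) (x : ℝ) :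
    truncFourierFun c φ x = 0 := by
  refine truncFourierFun_eq_zero_of_Ioo c φ hlr (fun y hy => ?_) x
  exact Measure.eqOn_open_of_ae_eq (g := fun _ => (0 : ℂ)) h isOpen_Ioo
    (truncFourierFun_continuous c φ).continuousOn continuousOn_const hy

/-! ### Fourier synthesis on the line -/

/-- Extension by zero `L²([-1,1]) → L²(ℝ)`. -/
noncomputable def zeroExt (φ : L2I) : L2R :=
  ((memLp_indicator_iff_restrict measurableSet_Icc).2 (Lp.memLp φ)).toLp
    ((Icc (-1 : ℝ) 1).indicator φ)

theorem inner_zeroExt (φ ψ : L2I) : inner ℂ (zeroExt φ) (zeroExt ψ) = inner ℂ φ ψ := by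
  rw [L2.inner_def, L2.inner_def, ← integral_indicator measurableSet_Icc]
  refine integral_congr_ae ?_
  filter_upwards [((memLp_indicator_iff_restrict measurableSet_Icc).2 (Lp.memLp φ)).coeFn_toLp,
    ((memLp_indicator_iff_restrict measurableSet_Icc).2 (Lp.memLp ψ)).coeFn_toLp] with x h1 h2
  rw [zeroExt, zeroExt, h1, h2]
  by_cases hx : x ∈ Icc (-1 : ℝ) 1 <;> simp [hx]

theorem truncFourierFun_eq_fourier (c : ℝ) (φ : L2I) (x : ℝ) :
    truncFourierFun c φ x =
      𝓕 ((Icc (-1 : ℝ) 1).indicator φ : ℝ → ℂ) (-(c / (2 * Real.pi)) * x) := by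
  rw [Real.fourier_real_eq_integral_exp_smul, truncFourierFun, ← integral_indicator
    measurableSet_Icc]
  refine integral_congr_ae (Eventually.of_forall fun b => ?_)
  simp only [indicator]
  split_ifs
  · rw [smul_eq_mul]
    congr 2
    push_cast
    have : (Real.pi : ℂ) ≠ 0 := by exact_mod_cast Real.pi_ne_zero
    field_simp
  · simp

/-- Plancherel after the change of variable `ξ = -(c / 2π) x`, whose Jacobian gives the factor. -/
theorem integral_inner_truncFourierFun (c : ℝ) (φ ψ : L2I) :
    ∫ x, inner ℂ (truncFourierFun c φ x) (truncFourierFun c ψ x) =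
      ((|2 * Real.pi / c| : ℝ) : ℂ) * inner ℂ φ ψ := by
  have hint : ∀ φ : L2I, Integrable ((Icc (-1 : ℝ) 1).indicator φ) := fun φ =>
    (integrable_indicator_iff measurableSet_Icc).2 (L2I_integrable φ)
  have hmem : ∀ φ : L2I, MemLp ((Icc (-1 : ℝ) 1).indicator φ) 2 volume := fun φ =>
    (memLp_indicator_iff_restrict measurableSet_Icc).2 (Lp.memLp φ)
  simp only [truncFourierFun_eq_fourier]
  rw [Measure.integral_comp_mul_left (fun y => inner ℂ (𝓕 ((Icc (-1 : ℝ) 1).indicator φ : ℝ → ℂ) y)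
    (𝓕 ((Icc (-1 : ℝ) 1).indicator ψ : ℝ → ℂ) y))]
  have h1 : ∫ y, inner ℂ (𝓕 ((Icc (-1 : ℝ) 1).indicator φ : ℝ → ℂ) y)
      (𝓕 ((Icc (-1 : ℝ) 1).indicator ψ : ℝ → ℂ) y) =
      inner ℂ (𝓕 (zeroExt φ) : L2R) (𝓕 (zeroExt ψ) : L2R) := by
    rw [L2.inner_def]
    refine integral_congr_ae ?_
    filter_upwards [fourier_ae_eq_fourier_toLp (hint φ) (hmem φ),
      fourier_ae_eq_fourier_toLp (hint ψ) (hmem ψ)] with y h1 h2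
    rw [h1, h2]
    rfl
  rw [h1, Lp.inner_fourier_eq, inner_zeroExt, Complex.real_smul]
  congr 2
  rw [abs_inv, abs_neg, ← abs_inv, inv_div]

/-- The synthesis operator `L²([-1,1]) → L²(ℝ)`, `φ ↦ F[φ](a ·)`. -/
noncomputable def synthesis {a : ℝ} (ha : a ≠ 0) : L2I →ₗ[ℂ] L2R where
  toFun φ := (memLp_truncFourierFun ha φ).toLp _
  map_add' φ ψ := by
    rw [← MemLp.toLp_add]
    congr 1
    ext x
    exact truncFourierFun_add a φ ψ x
  map_smul' r φ := by
    rw [RingHom.id_apply, ← MemLp.toLp_const_smul]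
    congr 1
    ext x
    exact truncFourierFun_smul a r φ x

theorem coeFn_synthesis {a : ℝ} (ha : a ≠ 0) (φ : L2I) :
    synthesis ha φ =ᵐ[volume] truncFourierFun a φ :=
  (memLp_truncFourierFun ha φ).coeFn_toLp

theorem inner_synthesis {a : ℝ} (ha : 0 < a) (φ ψ : L2I) :
    inner ℂ (synthesis ha.ne' φ) (synthesis ha.ne' ψ) =
      ((2 * Real.pi / a : ℝ) : ℂ) * inner ℂ φ ψ := by
  rw [L2.inner_def, ← abs_of_pos (show 0 < 2 * Real.pi / a by positivity),
    ← integral_inner_truncFourierFun]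
  refine integral_congr_ae ?_
  filter_upwards [coeFn_synthesis ha.ne' φ, coeFn_synthesis ha.ne' ψ] with x h1 h2
  rw [h1, h2]

theorem norm_sq_synthesis {a : ℝ} (ha : 0 < a) (φ : L2I) :
    ‖synthesis ha.ne' φ‖ ^ 2 = 2 * Real.pi / a * ‖φ‖ ^ 2 := by
  have h := congrArg Complex.re (inner_synthesis ha φ φ)
  rw [Complex.re_ofReal_mul] at h
  rw [← inner_self_eq_norm_sq (𝕜 := ℂ), ← inner_self_eq_norm_sq (𝕜 := ℂ)]
  exact h

theorem continuous_synthesis {a : ℝ} (ha : 0 < a) : Continuous (synthesis ha.ne') := by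
  refine AddMonoidHomClass.continuous_of_bound _ (Real.sqrt (2 * Real.pi / a)) fun φ => ?_
  refine abs_le_of_sq_le_sq' ?_ (by positivity) |>.2
  rw [mul_pow, Real.sq_sqrt (by positivity), norm_sq_synthesis ha]

theorem eq_zero_of_truncFourierFun_eq_zero {a : ℝ} (ha : 0 < a) {φ : L2I}
    (h : ∀ x, truncFourierFun a φ x = 0) : φ = 0 := by
  have h1 : synthesis ha.ne' φ = 0 := by
    rw [Lp.eq_zero_iff_ae_eq_zero]
    filter_upwards [coeFn_synthesis ha.ne' φ] with x hx
    rw [hx, h x]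
    rfl
  have h2 := norm_sq_synthesis ha φ
  rw [h1, norm_zero, zero_pow two_ne_zero] at h2
  have h3 : 0 < 2 * Real.pi / a := by positivity
  have h4 : ‖φ‖ ^ 2 = 0 := by
    rcases mul_eq_zero.1 h2.symm with h | h
    · exact absurd h h3.ne'
    · exact h
  simpa using h4

theorem coeFn_truncFourier (c : ℝ) (φ : L2I) :
    truncFourier c φ =ᵐ[volume.restrict (Icc (-1 : ℝ) 1)] truncFourierFun c φ :=
  (memLp_truncFourierFun_Icc c φ).coeFn_toLp

/-- A kernel element synthesises a function vanishing on `[-1,1]`, hence everywhere by analyticity,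
and Plancherel makes the element zero. -/
theorem truncFourier_injective {c : ℝ} (hc : 0 < c) : Function.Injective (truncFourier c) := by
  rw [injective_iff_map_eq_zero]
  intro φ hφ
  refine eq_zero_of_truncFourierFun_eq_zero hc
    (truncFourierFun_eq_zero_of_ae_Ioo c φ (l := -1) (r := 1) (by norm_num) ?_)
  refine ae_restrict_of_ae_restrict_of_subset Ioo_subset_Icc_self ?_
  have h1 := coeFn_truncFourier c φ
  rw [hφ] at h1
  filter_upwards [h1, Lp.coeFn_zero ℂ 2 (volume.restrict (Icc (-1 : ℝ) 1))] with x h1 h2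
  rw [← h1, h2]
  rfl

/-- The inner product of two synthesised functions over `[-ε,ε]`. -/
theorem setIntegral_inner_truncFourierFun {a ε : ℝ} (hε : 0 < ε) (φ ψ : L2I) :
    ∫ x in Icc (-ε) ε, inner ℂ (truncFourierFun a φ x) (truncFourierFun a ψ x) =
      (ε : ℂ) * inner ℂ (truncFourier (a * ε) φ) (truncFourier (a * ε) ψ) := by
  have h1 : inner ℂ (truncFourier (a * ε) φ) (truncFourier (a * ε) ψ) =
      ∫ x in Icc (-1 : ℝ) 1, inner ℂ (truncFourierFun a φ (ε * x)) (truncFourierFun a ψ (ε * x)) := by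
    rw [L2.inner_def]
    refine integral_congr_ae ?_
    filter_upwards [coeFn_truncFourier (a * ε) φ, coeFn_truncFourier (a * ε) ψ] with x h1 h2
    rw [h1, h2, truncFourierFun_mul_scale, truncFourierFun_mul_scale]
  rw [h1, integral_Icc_eq_integral_Ioc, integral_Icc_eq_integral_Ioc,
    ← intervalIntegral.integral_of_le (by linarith), ← intervalIntegral.integral_of_le (by norm_num),
    intervalIntegral.integral_comp_mul_left
      (fun x => inner ℂ (truncFourierFun a φ x) (truncFourierFun a ψ x)) hε.ne', Complex.real_smul,
    ← mul_assoc, Complex.ofReal_inv, mul_inv_cancel₀ (by exact_mod_cast hε.ne'), one_mul]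
  congr 1 <;> ring

theorem inner_restrictIcc_synthesis {a ε : ℝ} (ha : a ≠ 0) (hε : 0 < ε) (φ ψ : L2I) :
    inner ℂ (restrictIcc ε (synthesis ha φ)) (restrictIcc ε (synthesis ha ψ)) =
      (ε : ℂ) * inner ℂ (truncFourier (a * ε) φ) (truncFourier (a * ε) ψ) := by
  rw [← setIntegral_inner_truncFourierFun hε, L2.inner_def]
  have hr : ∀ f : L2R, restrictIcc ε f =ᵐ[volume.restrict (Icc (-ε) ε)] f := fun f =>
    LpToLpRestrictCLM_coeFn ℂ _ f
  refine integral_congr_ae ?_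
  filter_upwards [hr (synthesis ha φ), hr (synthesis ha ψ),
    ae_restrict_of_ae (coeFn_synthesis ha φ), ae_restrict_of_ae (coeFn_synthesis ha ψ)]
    with x h1 h2 h3 h4
  rw [h1, h2, h3, h4]

/-! ### The Paley–Wiener theorem -/

/-- For `f ∈ L¹(ℝ) ∩ L²(ℝ)` the inverse Fourier integral coincides with the inverse `L²` Fourier
transform. -/
theorem fourierInv_ae_eq_fourierInv_toLp {f : ℝ → ℂ} (hf : Integrable f) (hf2 : MemLp f 2 volume) :
    𝓕⁻ f =ᵐ[volume] (𝓕⁻ (hf2.toLp f) : L2R) := by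
  have hc : Continuous (𝓕⁻ f) := by
    rw [Real.fourierInv_eq_fourier_comp_neg]
    exact VectorFourier.fourierIntegral_continuous Real.continuous_fourierChar
      (by exact continuous_inner) hf.comp_neg
  refine ae_eq_of_integral_contDiff_smul_eq hc.locallyIntegrable
    ((Lp.memLp _).locallyIntegrable (by norm_num)) ?_
  intro u hu hsu
  have hsu' : HasCompactSupport (Complex.ofRealCLM ∘ u) := hsu.comp_left rfl
  have hu' : ContDiff ℝ ∞ (Complex.ofRealCLM ∘ u) := by fun_prop
  set w : SchwartzMap ℝ ℂ := hsu'.toSchwartzMap hu' with hw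
  have hwu : ∀ x, w x = (u x : ℂ) := fun x => rfl
  have key := congrArg (fun T => T w) (Lp.fourierInv_toTemperedDistribution_eq (hf2.toLp f))
  simp only [TemperedDistribution.fourierInv_apply, Lp.toTemperedDistribution_apply] at key
  have e1 : ∫ x, u x • (𝓕⁻ (hf2.toLp f) : L2R) x = ∫ x, w x • (𝓕⁻ (hf2.toLp f) : L2R) x := by
    refine integral_congr_ae (Eventually.of_forall fun x => ?_)
    simp only [hwu, smul_eq_mul, Complex.real_smul]
  have e2 : ∫ x, u x • (𝓕⁻ f) x = ∫ x, w x • (𝓕⁻ f) x := by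
    refine integral_congr_ae (Eventually.of_forall fun x => ?_)
    simp only [hwu, smul_eq_mul, Complex.real_smul]
  rw [e1, e2, ← key]
  -- The substitution `x ↦ -x` trades the inverse transform for the direct one, so that the flip
  -- formula applies to `f (-x)`.
  have e3 : ∫ x, (𝓕⁻ w) x • (hf2.toLp f : L2R) x = ∫ x, (𝓕 (w : ℝ → ℂ)) x • f (-x) := by
    refine Eq.trans ?_ (integral_neg_eq_self (fun x => (𝓕 (w : ℝ → ℂ)) x • f (-x)) volume)
    refine integral_congr_ae ?_
    filter_upwards [hf2.coeFn_toLp] with x hx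
    rw [hx, SchwartzMap.fourierInv_coe, Real.fourierInv_eq_fourier_neg, neg_neg]
  rw [e3, Real.fourierInv_eq_fourier_comp_neg]
  have := VectorFourier.integral_fourierIntegral_smul_eq_flip (μ := volume) (ν := volume)
    (L := innerₗ ℝ) Real.continuous_fourierChar (by exact continuous_inner)
    (w.integrable) hf.comp_neg
  rw [flip_innerₗ] at this
  exact this.symm

/-- Every function of `PW(a)` is synthesised from a function of `L²([-1,1])`. -/
theorem exists_synthesis_eq_of_mem_paleyWiener {a : ℝ} (ha : 0 < a) {u : L2R}
    (hu : u ∈ paleyWiener a) : ∃ φ, synthesis ha.ne' φ = u := by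
  set k : ℝ := a / (2 * Real.pi) with hk
  have hk0 : 0 < k := by positivity
  set w : L2R := 𝓕 u with hw
  have hw0 : ∀ᵐ ξ : ℝ, ξ ∉ Icc (-k) k → w ξ = 0 := by
    have hq : Measure.QuasiMeasurePreserving (fun x : ℝ => -(2 * Real.pi) * x) volume volume := by
      refine ⟨by fun_prop, ?_⟩
      rw [Real.map_volume_mul_left (by simp [Real.pi_ne_zero])]
      exact Measure.smul_absolutelyContinuous
    filter_upwards [hq.ae hu] with ξ hξ hξk
    have h1 := hξ (fun h => hξk ?_)
    · rw [fourierL2] at h1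
      convert h1 using 2
      field_simp
    · rw [hk, mem_Icc]
      rw [mem_Icc] at h
      constructor
      · rw [← neg_div, div_le_iff₀ (by positivity)]; linarith
      · rw [le_div_iff₀ (by positivity)]; linarith
  have hwind : (w : ℝ → ℂ) =ᵐ[volume] (Icc (-k) k).indicator w := by
    filter_upwards [hw0] with ξ hξ
    by_cases h : ξ ∈ Icc (-k) k
    · rw [indicator_of_mem h]
    · rw [indicator_of_notMem h, hξ h]
  have hwint : Integrable w := by
    refine Integrable.congr ?_ hwind.symm
    rw [integrable_indicator_iff measurableSet_Icc]
    exact ((Lp.memLp w).restrict _).integrable (by norm_num)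
  -- The preimage is `φ(b) = k w(k b)`: with `ξ = k b` one has `a b = 2π ξ`, and `[-1,1]` becomes
  -- the frequency band `[-k,k]`.
  have hscale : MemLp (fun b : ℝ => (k : ℂ) * w (k * b)) 2 volume := by
    have h3 : MemLp (w : ℝ → ℂ) 2 (Measure.map (fun x : ℝ => k * x) volume) := by
      rw [Real.map_volume_mul_left hk0.ne']
      exact (Lp.memLp w).smul_measure ENNReal.ofReal_ne_top
    exact (h3.comp_of_map (by fun_prop)).const_mul _
  refine ⟨(hscale.restrict (Icc (-1) 1)).toLp _, ?_⟩
  have hinv : u = 𝓕⁻ w := (FourierTransform.fourierInv_fourier_eq u).symm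
  have hinv2 : (𝓕⁻ (w : ℝ → ℂ)) =ᵐ[volume] u := by
    have := fourierInv_ae_eq_fourierInv_toLp hwint (Lp.memLp w)
    rwa [Lp.toLp_coeFn, ← hinv] at this
  refine Lp.ext ((coeFn_synthesis _ _).trans (EventuallyEq.trans ?_ hinv2))
  refine Eventually.of_forall fun x => ?_
  have h1 : truncFourierFun a ((hscale.restrict (Icc (-1) 1)).toLp _) x =
      ∫ b in Icc (-1 : ℝ) 1, (k : ℂ) *
        (Complex.exp (((2 * Real.pi * ((k * b) * x) : ℝ) : ℂ) * Complex.I) * w (k * b)) := by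
    refine integral_congr_ae ?_
    filter_upwards [(hscale.restrict (Icc (-1) 1)).coeFn_toLp] with b hb
    rw [hb, mul_comm Complex.I, mul_left_comm]
    congr 5
    rw [hk]
    field_simp
  have h2 : 𝓕⁻ (w : ℝ → ℂ) x = ∫ ξ in Icc (-k) k,
      Complex.exp (((2 * Real.pi * (ξ * x) : ℝ) : ℂ) * Complex.I) * w ξ := by
    rw [Real.fourierInv_eq', ← integral_indicator measurableSet_Icc]
    refine integral_congr_ae ?_
    filter_upwards [hw0] with ξ hξ
    by_cases h : ξ ∈ Icc (-k) k
    · rw [indicator_of_mem h, smul_eq_mul]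
      congr 5
      simp [mul_comm]
    · rw [indicator_of_notMem h, hξ h, smul_zero]
  rw [h1, h2, integral_const_mul, integral_Icc_eq_integral_Ioc, integral_Icc_eq_integral_Ioc,
    ← intervalIntegral.integral_of_le (show (-1 : ℝ) ≤ 1 by norm_num),
    ← intervalIntegral.integral_of_le (show -k ≤ k by linarith),
    intervalIntegral.integral_comp_mul_left (fun ξ : ℝ =>
      Complex.exp (((2 * Real.pi * (ξ * x) : ℝ) : ℂ) * Complex.I) * w ξ) hk0.ne', Complex.real_smul,
    ← mul_assoc, Complex.ofReal_inv, mul_inv_cancel₀ (by exact_mod_cast hk0.ne'), one_mul]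
  congr 1 <;> ring

theorem paleyWienerProj_mem (a : ℝ) (f : L2R) : paleyWienerProj a f ∈ paleyWiener a := by
  filter_upwards [fourierL2_paleyWienerProj a f] with x hx hxa
  rw [hx, indicator_of_notMem hxa]

/-! ### Compactness of the truncated Fourier operator -/

theorem memLp_monomial (n : ℕ) :
    MemLp (fun b : ℝ => (b : ℂ) ^ n) 2 (volume.restrict (Icc (-1 : ℝ) 1)) := by
  refine MemLp.of_bound (by fun_prop : Continuous _).aestronglyMeasurable 1 ?_
  filter_upwards [ae_restrict_mem measurableSet_Icc] with b hb
  rw [norm_pow, Complex.norm_real]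
  exact pow_le_one₀ (norm_nonneg _) (abs_le.2 hb)

/-- The monomial `b ^ n` as an element of `L²([-1,1])`. -/
noncomputable def monomialL2 (n : ℕ) : L2I := (memLp_monomial n).toLp _

theorem inner_monomialL2 (n : ℕ) (φ : L2I) :
    inner ℂ (monomialL2 n) φ = ∫ b in Icc (-1 : ℝ) 1, (b : ℂ) ^ n * φ b := by
  rw [L2.inner_def]
  refine integral_congr_ae ?_
  filter_upwards [(memLp_monomial n).coeFn_toLp] with b hb
  rw [monomialL2, hb, RCLike.inner_apply, map_pow, Complex.conj_ofReal, mul_comm]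

/-- The finite rank operator whose kernel is the Taylor polynomial of `exp (i c b x)`. -/
noncomputable def taylorOperator (c : ℝ) (N : ℕ) : L2I →L[ℂ] L2I :=
  ∑ n ∈ Finset.range N, ((Complex.I * c) ^ n / (n.factorial : ℂ)) •
    (innerSL ℂ (monomialL2 n)).smulRight (monomialL2 n)

theorem isCompactOperator_smulRight {H K : Type*} [NormedAddCommGroup H] [NormedSpace ℂ H]
    [NormedAddCommGroup K] [NormedSpace ℂ K] (l : H →L[ℂ] ℂ) (y : K) :
    IsCompactOperator (l.smulRight y) := by
  have h : IsCompactOperator (ContinuousLinearMap.toSpanSingleton ℂ y) :=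
    isCompactOperator_of_locallyCompactSpace_rng (ContinuousLinearMap.toSpanSingleton ℂ y)
  exact h.comp_clm l

theorem isCompactOperator_taylorOperator (c : ℝ) (N : ℕ) :
    IsCompactOperator (taylorOperator c N) := by
  have : taylorOperator c N ∈ compactOperator (RingHom.id ℂ) L2I L2I := by
    refine Submodule.sum_mem _ fun n _ => Submodule.smul_mem _ _ ?_
    exact isCompactOperator_smulRight _ _
  exact this

theorem coeFn_finset_sum_Lp {α ι : Type*} [MeasurableSpace α] {μ : Measure α} (s : Finset ι)
    (f : ι → Lp ℂ 2 μ) : (∑ i ∈ s, f i : Lp ℂ 2 μ) =ᵐ[μ] fun x => ∑ i ∈ s, f i x := by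
  classical
  induction s using Finset.induction_on with
  | empty =>
    simp only [Finset.sum_empty]
    exact Lp.coeFn_zero ℂ 2 μ
  | insert i s hi ih =>
    rw [Finset.sum_insert hi]
    filter_upwards [Lp.coeFn_add (f i) (∑ i ∈ s, f i), ih] with x h1 h2
    rw [h1, Pi.add_apply, h2, Finset.sum_insert hi]

theorem coeFn_taylorOperator (c : ℝ) (N : ℕ) (φ : L2I) :
    taylorOperator c N φ =ᵐ[volume.restrict (Icc (-1 : ℝ) 1)] fun x =>
      ∫ b in Icc (-1 : ℝ) 1,
        (∑ n ∈ Finset.range N, (Complex.I * ((c * b * x : ℝ) : ℂ)) ^ n / (n.factorial : ℂ)) * φ b := by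
  have h1 : taylorOperator c N φ = ∑ n ∈ Finset.range N,
      ((Complex.I * c) ^ n / (n.factorial : ℂ) * inner ℂ (monomialL2 n) φ) • monomialL2 n := by
    simp [taylorOperator, smul_smul]
  have h2 : ∀ᵐ x ∂(volume.restrict (Icc (-1 : ℝ) 1)), ∀ n : ℕ,
      (((Complex.I * c) ^ n / (n.factorial : ℂ) * inner ℂ (monomialL2 n) φ) • monomialL2 n : L2I) x =
      ((Complex.I * c) ^ n / (n.factorial : ℂ) * inner ℂ (monomialL2 n) φ) * (x : ℂ) ^ n := by
    rw [ae_all_iff]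
    intro n
    filter_upwards [Lp.coeFn_smul ((Complex.I * c) ^ n / (n.factorial : ℂ) *
      inner ℂ (monomialL2 n) φ) (monomialL2 n), (memLp_monomial n).coeFn_toLp] with x h1 h2
    rw [h1, Pi.smul_apply, smul_eq_mul, monomialL2, h2]
  rw [h1]
  filter_upwards [coeFn_finset_sum_Lp (Finset.range N) (fun n =>
    ((Complex.I * c) ^ n / (n.factorial : ℂ) * inner ℂ (monomialL2 n) φ) • monomialL2 n), h2]
    with x h3 h4
  rw [h3]
  simp only [h4, Finset.sum_mul]
  have hint : ∀ n : ℕ, Integrable (fun b : ℝ => (b : ℂ) ^ n * φ b)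
      (volume.restrict (Icc (-1 : ℝ) 1)) := by
    intro n
    refine (L2I_integrable φ).bdd_mul (c := 1)
      (by fun_prop : Continuous _).aestronglyMeasurable ?_
    filter_upwards [ae_restrict_mem measurableSet_Icc] with b hb
    rw [norm_pow, Complex.norm_real]
    exact pow_le_one₀ (norm_nonneg _) (abs_le.2 hb)
  have hterm : ∀ (n : ℕ) (b : ℝ),
      (Complex.I * ((c * b * x : ℝ) : ℂ)) ^ n / (n.factorial : ℂ) * φ b =
      ((Complex.I * c) ^ n / (n.factorial : ℂ) * (x : ℂ) ^ n) * ((b : ℂ) ^ n * φ b) := by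
    intro n b
    push_cast
    simp only [mul_pow]
    ring
  simp only [hterm]
  rw [integral_finsetSum _ fun n _ => (hint n).const_mul _]
  refine Finset.sum_congr rfl fun n _ => ?_
  rw [integral_const_mul, inner_monomialL2]
  ring

theorem integral_norm_le (φ : L2I) : ∫ b in Icc (-1 : ℝ) 1, ‖φ b‖ ≤ Real.sqrt 2 * ‖φ‖ := by
  have h2 : eLpNorm φ 1 (volume.restrict (Icc (-1 : ℝ) 1)) ≤
      eLpNorm φ 2 (volume.restrict (Icc (-1 : ℝ) 1)) * ENNReal.ofReal (Real.sqrt 2) := by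
    refine (eLpNorm_le_eLpNorm_mul_rpow_measure_univ (p := 1) (q := 2) (by norm_num)
      (Lp.aestronglyMeasurable φ)).trans (le_of_eq ?_)
    congr 1
    rw [Measure.restrict_apply_univ, Real.volume_Icc, ENNReal.ofReal_rpow_of_pos (by norm_num),
      Real.sqrt_eq_rpow]
    norm_num
  rw [integral_norm_eq_lintegral_enorm (Lp.aestronglyMeasurable φ), ← eLpNorm_one_eq_lintegral_enorm]
  refine (ENNReal.toReal_mono (ENNReal.mul_ne_top (Lp.eLpNorm_ne_top φ) ENNReal.ofReal_ne_top)
    h2).trans (le_of_eq ?_)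
  rw [ENNReal.toReal_mul, ENNReal.toReal_ofReal (Real.sqrt_nonneg 2), mul_comm, Lp.norm_def]

theorem norm_le_of_ae_norm_le {f : L2I} {C : ℝ} (hC : 0 ≤ C)
    (h : ∀ᵐ x ∂(volume.restrict (Icc (-1 : ℝ) 1)), ‖f x‖ ≤ C) : ‖f‖ ≤ Real.sqrt 2 * C := by
  refine (Lp.norm_le_of_ae_bound hC h).trans (le_of_eq ?_)
  have h2 : volume.restrict (Icc (-1 : ℝ) 1) univ = 2 := by
    rw [Measure.restrict_apply_univ, Real.volume_Icc]
    norm_num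
  simp only [measureUnivNNReal, h2, ENNReal.coe_toNNReal_eq_toReal, ENNReal.toReal_ofNat]
  rw [Real.sqrt_eq_rpow]
  norm_num

/-- The kernels differ by at most the exponential remainder `2 |c|^N / N!`, available because `2 |c|
≤ N`. Passing from `L²` to `L¹` and from a uniform bound back to `L²` costs `√2` each time, whence
`4`. -/
theorem norm_truncFourier_sub_taylorOperator_le {c : ℝ} {N : ℕ} (hN : 2 * |c| ≤ N) :
    ‖truncFourier c - taylorOperator c N‖ ≤ 4 * (|c| ^ N / (N.factorial : ℝ)) := by
  refine ContinuousLinearMap.opNorm_le_bound _ (by positivity) fun φ => ?_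
  have hk : ∀ x ∈ Icc (-1 : ℝ) 1, ∀ b ∈ Icc (-1 : ℝ) 1,
      ‖Complex.exp (Complex.I * ((c * b * x : ℝ) : ℂ)) - ∑ n ∈ Finset.range N,
        (Complex.I * ((c * b * x : ℝ) : ℂ)) ^ n / (n.factorial : ℂ)‖ ≤
      |c| ^ N / (N.factorial : ℝ) * 2 := by
    intro x hx b hb
    have hn : ‖Complex.I * ((c * b * x : ℝ) : ℂ)‖ ≤ |c| := by
      rw [norm_mul, Complex.norm_I, one_mul, Complex.norm_real, Real.norm_eq_abs, abs_mul, abs_mul]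
      have h1 : |b| ≤ 1 := abs_le.2 hb
      have h2 : |x| ≤ 1 := abs_le.2 hx
      calc |c| * |b| * |x| ≤ |c| * 1 * 1 := by gcongr
        _ = |c| := by ring
    refine (Complex.exp_bound' ?_).trans ?_
    · rw [div_le_iff₀ (by positivity)]
      rw [Nat.cast_succ]
      linarith
    · gcongr
  have hb : ∀ᵐ x ∂(volume.restrict (Icc (-1 : ℝ) 1)),
      ‖((truncFourier c - taylorOperator c N) φ : L2I) x‖ ≤
        |c| ^ N / (N.factorial : ℝ) * 2 * (Real.sqrt 2 * ‖φ‖) := by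
    filter_upwards [Lp.coeFn_sub (truncFourier c φ) (taylorOperator c N φ),
      coeFn_truncFourier c φ, coeFn_taylorOperator c N φ, ae_restrict_mem measurableSet_Icc]
      with x h1 h2 h3 hx
    have hint : Integrable (fun b : ℝ => (∑ n ∈ Finset.range N,
        (Complex.I * ((c * b * x : ℝ) : ℂ)) ^ n / (n.factorial : ℂ)) * φ b)
        (volume.restrict (Icc (-1 : ℝ) 1)) := by
      have hcont : Continuous fun b : ℝ => ∑ n ∈ Finset.range N,
          (Complex.I * ((c * b * x : ℝ) : ℂ)) ^ n / (n.factorial : ℂ) := by fun_prop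
      obtain ⟨M, hM⟩ := isCompact_Icc.exists_bound_of_continuousOn
        (hcont.continuousOn (s := Icc (-1 : ℝ) 1))
      refine (L2I_integrable φ).bdd_mul (c := M) hcont.aestronglyMeasurable ?_
      filter_upwards [ae_restrict_mem measurableSet_Icc] with b hb
      exact hM b hb
    rw [sub_apply, h1, Pi.sub_apply, h2, h3, truncFourierFun,
      ← integral_sub (truncFourier_integrand_integrable c φ x) hint]
    calc _ ≤ ∫ b in Icc (-1 : ℝ) 1, |c| ^ N / (N.factorial : ℝ) * 2 * ‖φ b‖ := by
          refine norm_integral_le_of_norm_le ((L2I_integrable φ).norm.const_mul _) ?_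
          filter_upwards [ae_restrict_mem measurableSet_Icc] with b hb
          rw [← sub_mul, norm_mul]
          exact mul_le_mul_of_nonneg_right (hk x hx b hb) (norm_nonneg _)
      _ ≤ _ := by
          rw [integral_const_mul]
          exact mul_le_mul_of_nonneg_left (integral_norm_le φ) (by positivity)
  refine (norm_le_of_ae_norm_le (by positivity) hb).trans (le_of_eq ?_)
  have := Real.mul_self_sqrt (show (0 : ℝ) ≤ 2 by norm_num)
  linear_combination (|c| ^ N / (N.factorial : ℝ) * 2 * ‖φ‖) * this

theorem isCompactOperator_truncFourier (c : ℝ) : IsCompactOperator (truncFourier c) := by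
  refine isCompactOperator_of_tendsto (F := taylorOperator c) (l := atTop) ?_
    (Eventually.of_forall (isCompactOperator_taylorOperator c))
  rw [tendsto_iff_norm_sub_tendsto_zero]
  have hlim := (FloorSemiring.tendsto_pow_div_factorial_atTop |c|).const_mul 4
  rw [mul_zero] at hlim
  refine squeeze_zero' (Eventually.of_forall fun N => norm_nonneg _) ?_ hlim
  filter_upwards [eventually_ge_atTop ⌈2 * |c|⌉₊] with N hN
  rw [norm_sub_rev]
  exact norm_truncFourier_sub_taylorOperator_le (Nat.ceil_le.1 hN)

/-- Indicators of the disjoint intervals `(1/(n+2), 1/(n+1)]` are nonzero and orthogonal. Infinite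
dimension is what keeps the construction of singular vectors from stopping. -/
theorem not_finiteDimensional_L2I : ¬ FiniteDimensional ℂ L2I := by
  intro hfin
  set s : ℕ → Set ℝ := fun n => Ioc (1 / ((n : ℝ) + 2)) (1 / ((n : ℝ) + 1)) with hs
  have hlt : ∀ n : ℕ, 1 / ((n : ℝ) + 2) < 1 / ((n : ℝ) + 1) := fun n =>
    one_div_lt_one_div_of_lt (by positivity) (by linarith)
  have hsub : ∀ n, s n ⊆ Icc (-1) 1 := by
    intro n x hx
    have h1 : (0 : ℝ) < 1 / ((n : ℝ) + 2) := by positivity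
    have h2 : 1 / ((n : ℝ) + 1) ≤ 1 := by
      rw [div_le_one (by positivity)]
      linarith [(Nat.cast_nonneg n : (0 : ℝ) ≤ n)]
    exact ⟨by linarith [hx.1], hx.2.trans h2⟩
  have hdisj : ∀ m n, m < n → s m ∩ s n = ∅ := by
    intro m n hmn
    rw [← disjoint_iff_inter_eq_empty, hs]
    refine disjoint_left.2 fun x hx hy => ?_
    have : 1 / ((n : ℝ) + 1) ≤ 1 / ((m : ℝ) + 2) := by
      refine one_div_le_one_div_of_le (by positivity) ?_
      have : (m : ℝ) + 1 ≤ n := by exact_mod_cast hmn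
      linarith
    linarith [hx.1, hy.2]
  have hμ : ∀ n, volume.restrict (Icc (-1 : ℝ) 1) (s n) ≠ ⊤ := fun n => measure_ne_top _ _
  have hpos : ∀ n, volume.restrict (Icc (-1 : ℝ) 1) (s n) ≠ 0 := by
    intro n
    rw [Measure.restrict_apply measurableSet_Ioc, inter_eq_left.2 (hsub n), hs, Real.volume_Ioc]
    simpa using hlt n
  set f : ℕ → L2I := fun n => indicatorConstLp 2 (measurableSet_Ioc (a := 1 / ((n : ℝ) + 2))
    (b := 1 / ((n : ℝ) + 1))) (hμ n) (1 : ℂ) with hf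
  have hzero : ∀ m n, m < n → inner ℂ (f m) (f n) = 0 := by
    intro m n hmn
    rw [hf, L2.inner_indicatorConstLp_indicatorConstLp]
    have := hdisj m n hmn
    simp only [hs] at this
    rw [this]
    simp
  have hli : LinearIndependent ℂ f := by
    refine linearIndependent_of_ne_zero_of_inner_eq_zero (fun n h => ?_) fun m n hmn => ?_
    · have h1 := norm_indicatorConstLp (p := 2) (hs := measurableSet_Ioc (a := 1 / ((n : ℝ) + 2))
        (b := 1 / ((n : ℝ) + 1))) (hμs := hμ n) (c := (1 : ℂ)) (by norm_num) (by norm_num)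
      change ‖f n‖ = _ at h1
      rw [h, norm_zero, norm_one, one_mul] at h1
      have h2 : 0 < (volume.restrict (Icc (-1 : ℝ) 1)).real (s n) :=
        ENNReal.toReal_pos (hpos n) (hμ n)
      exact (Real.rpow_pos_of_pos h2 _).ne h1
    · rcases lt_or_gt_of_ne hmn with h | h
      · exact hzero m n h
      · exact inner_eq_zero_symm.1 (hzero n m h)
  exact not_finite_iff_infinite.2 inferInstance hli.finite

theorem exists_isSingularSystem_truncFourier {c : ℝ} (hc : 0 < c) :
    ∃ σ φ g, IsSingularSystem (truncFourier c) σ φ g :=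
  exists_isSingularSystem (isCompactOperator_truncFourier c) (truncFourier_injective hc)
    not_finiteDimensional_L2I

theorem norm_truncFourier_le (c : ℝ) : ‖truncFourier c‖ ≤ 2 :=
  LinearMap.mkContinuous_norm_le _ (by norm_num) _

/-! ### Orthogonal series -/

section Orthogonal

variable {H : Type*} [NormedAddCommGroup H] [InnerProductSpace ℂ H] {x : ℕ → H} {t : ℕ → ℝ}

/-- The same functions are orthogonal with different norms on the line, inside and outside;
normalising reduces each case to orthonormal series. -/
theorem orthonormal_of_inner_eq (ht : ∀ m, 0 < t m)
    (hx : ∀ m n, inner ℂ (x m) (x n) = if m = n then (t m : ℂ) else 0) :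
    Orthonormal ℂ fun m => (((Real.sqrt (t m))⁻¹ : ℝ) : ℂ) • x m := by
  rw [orthonormal_iff_ite]
  intro m n
  rw [inner_smul_left, inner_smul_right, hx, Complex.conj_ofReal]
  split_ifs with h
  · subst h
    have := ht m
    have h1 : (Real.sqrt (t m))⁻¹ * ((Real.sqrt (t m))⁻¹ * t m) = 1 := by
      rw [← mul_assoc, ← mul_inv, Real.mul_self_sqrt this.le, inv_mul_cancel₀ this.ne']
    exact_mod_cast h1
  · simp

theorem norm_sq_mul_sqrt (ht : ∀ m, 0 < t m) (d : ℂ) (m : ℕ) :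
    ‖d * ((Real.sqrt (t m) : ℝ) : ℂ)‖ ^ 2 = ‖d‖ ^ 2 * t m := by
  rw [norm_mul, mul_pow, Complex.norm_real, Real.norm_of_nonneg (Real.sqrt_nonneg _),
    Real.sq_sqrt (ht m).le]

theorem smul_eq_smul_normalized (ht : ∀ m, 0 < t m) (d : ℂ) (m : ℕ) :
    d • x m = (d * ((Real.sqrt (t m) : ℝ) : ℂ)) • ((((Real.sqrt (t m))⁻¹ : ℝ) : ℂ) • x m) := by
  have : ((Real.sqrt (t m) : ℝ) : ℂ) ≠ 0 := by exact_mod_cast (Real.sqrt_pos.2 (ht m)).ne'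
  rw [smul_smul, mul_assoc, Complex.ofReal_inv, mul_inv_cancel₀ this, mul_one]

theorem summable_smul_of_inner_eq [CompleteSpace H] (ht : ∀ m, 0 < t m)
    (hx : ∀ m n, inner ℂ (x m) (x n) = if m = n then (t m : ℂ) else 0) {d : ℕ → ℂ}
    (hd : Summable fun m => ‖d m‖ ^ 2 * t m) : Summable fun m => d m • x m := by
  have := summable_smul_of_summable_norm_sq (orthonormal_of_inner_eq ht hx)
    (a := fun m => d m * ((Real.sqrt (t m) : ℝ) : ℂ)) (by simpa only [norm_sq_mul_sqrt ht] using hd)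
  simpa only [← smul_eq_smul_normalized ht] using this

theorem hasSum_norm_sq_of_inner_eq (ht : ∀ m, 0 < t m)
    (hx : ∀ m n, inner ℂ (x m) (x n) = if m = n then (t m : ℂ) else 0) {d : ℕ → ℂ} {y : H}
    (hd : HasSum (fun m => d m • x m) y) : HasSum (fun m => ‖d m‖ ^ 2 * t m) (‖y‖ ^ 2) := by
  have := hasSum_norm_sq (orthonormal_of_inner_eq ht hx)
    (a := fun m => d m * ((Real.sqrt (t m) : ℝ) : ℂ)) (x := y)
    (by simpa only [← smul_eq_smul_normalized ht] using hd)
  simpa only [norm_sq_mul_sqrt ht] using this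

/-- Bessel's inequality for an orthogonal family. -/
theorem bessel_of_inner_eq (ht : ∀ m, 0 < t m)
    (hx : ∀ m n, inner ℂ (x m) (x n) = if m = n then (t m : ℂ) else 0) (y : H) :
    Summable (fun m => ‖inner ℂ (x m) y / (t m : ℂ)‖ ^ 2 * t m) ∧
      ∑' m, ‖inner ℂ (x m) y / (t m : ℂ)‖ ^ 2 * t m ≤ ‖y‖ ^ 2 := by
  have hx' := orthonormal_of_inner_eq ht hx
  have key : ∀ m, ‖inner ℂ (x m) y / (t m : ℂ)‖ ^ 2 * t m =
      ‖inner ℂ ((((Real.sqrt (t m))⁻¹ : ℝ) : ℂ) • x m) y‖ ^ 2 := by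
    intro m
    have h1 := ht m
    rw [inner_smul_left, norm_mul, norm_div, Complex.conj_ofReal, Complex.norm_real,
      Complex.norm_real, Real.norm_of_nonneg h1.le, norm_inv,
      Real.norm_of_nonneg (Real.sqrt_nonneg _), div_pow, mul_pow, inv_pow, Real.sq_sqrt h1.le]
    field_simp
  simp only [key]
  exact ⟨hx'.inner_products_summable y, Orthonormal.tsum_inner_products_le y hx'⟩

end Orthogonal

/-- The left singular functions of an injective operator form a Hilbert basis. -/
theorem IsSingularSystem.hasSum_left {H K : Type*} [NormedAddCommGroup H] [InnerProductSpace ℂ H]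
    [CompleteSpace H] [NormedAddCommGroup K] [InnerProductSpace ℂ K] [CompleteSpace K]
    {A : H →L[ℂ] K} {σ : ℕ → ℝ} {φ : ℕ → H} {g : ℕ → K} (h : IsSingularSystem A σ φ g)
    (hinj : Function.Injective A) (f : H) : HasSum (fun m => inner ℂ (φ m) f • φ m) f := by
  -- The expansion converges by Bessel, and its image under `A` is the singular series of `A f`;
  -- injectivity then identifies its sum with `f`.
  have hs := summable_smul_of_summable_norm_sq h.orthonormal_left
    (h.orthonormal_left.inner_products_summable f)
  have h1 := hs.hasSum.mapL A
  have h2 := h.hasSum f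
  have h3 : (fun m => A (inner ℂ (φ m) f • φ m)) =
      fun m => ((σ m : ℂ) * inner ℂ (φ m) f) • g m := by
    ext1 m
    rw [map_smul, h.map_eq, smul_smul, mul_comm]
  rw [h3] at h1
  rw [← hinj (h1.unique h2)]
  convert hs.hasSum using 1
  rw [hinj (h1.unique h2)]

/-! ### Restriction to the outer region -/

/-- The restriction map `L²(ℝ) → L²(ℝ \ (-ε,ε))`. -/
noncomputable def restrictOuter (ε : ℝ) :
    L2R →L[ℂ] Lp ℂ 2 ((volume : Measure ℝ).restrict (Ioo (-ε) ε)ᶜ) :=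
  LpToLpRestrictCLM ℝ ℂ ℂ volume 2 (Ioo (-ε) ε)ᶜ

theorem coeFn_restrictOuter (ε : ℝ) (f : L2R) :
    restrictOuter ε f =ᵐ[volume.restrict (Ioo (-ε) ε)ᶜ] f :=
  LpToLpRestrictCLM_coeFn ℂ _ f

theorem inner_restrictOuter (ε : ℝ) (f g : L2R) : inner ℂ (restrictOuter ε f) (restrictOuter ε g) =
    ∫ x in (Ioo (-ε) ε)ᶜ, inner ℂ (f x) (g x) := by
  rw [L2.inner_def]
  refine integral_congr_ae ?_
  filter_upwards [coeFn_restrictOuter ε f, coeFn_restrictOuter ε g] with x h1 h2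
  rw [h1, h2]

theorem inner_eq_restrict_add (ε : ℝ) (f g : L2R) : inner ℂ f g =
    inner ℂ (restrictIcc ε f) (restrictIcc ε g) +
      inner ℂ (restrictOuter ε f) (restrictOuter ε g) := by
  -- The two regions overlap at most in the endpoints `±ε`, a null set.
  have h1 : inner ℂ (restrictIcc ε f) (restrictIcc ε g) = ∫ x in Ioo (-ε) ε, inner ℂ (f x) (g x) := by
    rw [L2.inner_def, ← integral_Icc_eq_integral_Ioo]
    refine integral_congr_ae ?_
    have hr : ∀ f : L2R, restrictIcc ε f =ᵐ[volume.restrict (Icc (-ε) ε)] f := fun f =>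
      LpToLpRestrictCLM_coeFn ℂ _ f
    filter_upwards [hr f, hr g] with x h1 h2
    rw [h1, h2]
  rw [h1, inner_restrictOuter, L2.inner_def]
  exact (integral_add_compl measurableSet_Ioo (L2.integrable_inner f g)).symm

theorem norm_sq_eq_restrict_add (ε : ℝ) (f : L2R) :
    ‖f‖ ^ 2 = ‖restrictIcc ε f‖ ^ 2 + ‖restrictOuter ε f‖ ^ 2 := by
  have h := congrArg Complex.re (inner_eq_restrict_add ε f f)
  rw [Complex.add_re] at h
  rw [← inner_self_eq_norm_sq (𝕜 := ℂ), ← inner_self_eq_norm_sq (𝕜 := ℂ),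
    ← inner_self_eq_norm_sq (𝕜 := ℂ)]
  exact h

theorem norm_sq_restrictOuter_sub (ε : ℝ) (f h : L2R) :
    ‖restrictOuter ε (f - h)‖ ^ 2 = ∫ x in (Ioo (-ε) ε)ᶜ, ‖f x - h x‖ ^ 2 := by
  rw [← inner_self_eq_norm_sq (𝕜 := ℂ), inner_restrictOuter]
  have h1 : ∫ x in (Ioo (-ε) ε)ᶜ, inner ℂ ((f - h) x) ((f - h) x) =
      ∫ x in (Ioo (-ε) ε)ᶜ, ((‖f x - h x‖ ^ 2 : ℝ) : ℂ) := by
    refine integral_congr_ae (ae_restrict_of_ae ?_)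
    filter_upwards [Lp.coeFn_sub f h] with x hx
    rw [hx, Pi.sub_apply, inner_self_eq_norm_sq_to_K]
    push_cast
    rfl
  rw [h1, integral_complex_ofReal]
  exact Complex.ofReal_re _

/-! ### Double orthogonality of the prolate spheroidal wave functions -/

section Prolate

variable {a ε : ℝ} (ha : 0 < a) (hε : 0 < ε) {σ : ℕ → ℝ} {φ g : ℕ → L2I}

theorem pswfDilated_eq (m : ℕ) :
    pswfDilated ha hε σ φ m = (σ m : ℂ)⁻¹ • synthesis ha.ne' (φ m) := by
  refine Lp.ext ?_
  filter_upwards [(memLp_pswf_dilated (mul_pos ha hε).ne' hε.ne' σ φ m).coeFn_toLp,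
    Lp.coeFn_smul (σ m : ℂ)⁻¹ (synthesis ha.ne' (φ m)), coeFn_synthesis ha.ne' (φ m)] with x h1 h2 h3
  rw [pswfDilated, h1, h2, Pi.smul_apply, h3, smul_eq_mul, pswf, truncFourierFun_mul_scale,
    mul_div_cancel₀ x hε.ne']

theorem outerCoeff_eq_inner (h : L2R) (m : ℕ) : outerCoeff a ε σ φ h m =
    inner ℂ (restrictOuter ε (pswfDilated ha hε σ φ m)) (restrictOuter ε h) := by
  rw [inner_restrictOuter]
  refine integral_congr_ae (ae_restrict_of_ae ?_)
  filter_upwards [(memLp_pswf_dilated (mul_pos ha hε).ne' hε.ne' σ φ m).coeFn_toLp] with x h1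
  rw [pswfDilated, h1, RCLike.inner_apply]

/-- The squared norm of `g_m(· / ε)` in `L²(ℝ \ (-ε,ε))`. -/
noncomputable def outerNormSq (a ε : ℝ) (σ : ℕ → ℝ) (m : ℕ) : ℝ :=
  2 * Real.pi / (a * σ m ^ 2) - ε

include ha hε in
theorem rho_pos (hσ : ∀ m, 0 < σ m) (m : ℕ) : 0 < rho (a * ε) σ m := by
  have := hσ m
  rw [rho, abs_of_pos (mul_pos ha hε)]
  positivity

include ha hε in
-- The right side is the reciprocal of the weight in the interpolation series.
theorem outerNormSq_eq (hσ : ∀ m, 0 < σ m) (m : ℕ) :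
    outerNormSq a ε σ m = (1 - rho (a * ε) σ m) * ε / rho (a * ε) σ m := by
  have := hσ m
  rw [outerNormSq, rho, abs_of_pos (mul_pos ha hε)]
  field_simp

variable (hs : IsSingularSystem (truncFourier (a * ε)) σ φ g)

include hs in
theorem inner_truncFourier_left (m : ℕ) (ψ : L2I) :
    inner ℂ (truncFourier (a * ε) (φ m)) (truncFourier (a * ε) ψ) =
      (σ m : ℂ) ^ 2 * inner ℂ (φ m) ψ := by
  rw [← ContinuousLinearMap.adjoint_inner_left, hs.map_eq, map_smul, hs.adjoint_eq, smul_smul,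
    inner_smul_left, map_mul, Complex.conj_ofReal, sq]

include hs in
theorem inner_pswfDilated (m n : ℕ) :
    inner ℂ (pswfDilated ha hε σ φ m) (pswfDilated ha hε σ φ n) =
      if m = n then ((2 * Real.pi / (a * σ m ^ 2) : ℝ) : ℂ) else 0 := by
  rw [pswfDilated_eq, pswfDilated_eq, inner_smul_left, inner_smul_right, inner_synthesis ha,
    orthonormal_iff_ite.1 hs.orthonormal_left]
  split_ifs with h
  · subst h
    have h1 : (σ m : ℂ) ≠ 0 := by exact_mod_cast (hs.pos m).ne'
    rw [map_inv₀, Complex.conj_ofReal]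
    push_cast
    field_simp
  · simp

include hs in
theorem inner_restrictIcc_pswfDilated (m n : ℕ) :
    inner ℂ (restrictIcc ε (pswfDilated ha hε σ φ m)) (restrictIcc ε (pswfDilated ha hε σ φ n)) =
      if m = n then (ε : ℂ) else 0 := by
  rw [pswfDilated_eq, pswfDilated_eq, map_smul, map_smul, inner_smul_left, inner_smul_right,
    inner_restrictIcc_synthesis ha.ne' hε, inner_truncFourier_left hs,
    orthonormal_iff_ite.1 hs.orthonormal_left]
  split_ifs with h
  · subst h
    have h1 : (σ m : ℂ) ≠ 0 := by exact_mod_cast (hs.pos m).ne'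
    rw [map_inv₀, Complex.conj_ofReal]
    field_simp
  · simp

include hs in
-- Plancherel on the line minus the inner product over `[-ε,ε]`. A general `ψ` is kept because
-- reproduction on `PW(a)` needs the outer coefficients of every synthesised function.
theorem inner_restrictOuter_pswfDilated_synthesis (m : ℕ) (ψ : L2I) :
    inner ℂ (restrictOuter ε (pswfDilated ha hε σ φ m)) (restrictOuter ε (synthesis ha.ne' ψ)) =
      (outerNormSq a ε σ m : ℂ) * ((σ m : ℂ) * inner ℂ (φ m) ψ) := by
  have h := inner_eq_restrict_add ε (pswfDilated ha hε σ φ m) (synthesis ha.ne' ψ)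
  rw [pswfDilated_eq, map_smul, inner_smul_left, inner_smul_left, inner_synthesis ha,
    inner_restrictIcc_synthesis ha.ne' hε, inner_truncFourier_left hs] at h
  rw [pswfDilated_eq, ← sub_eq_iff_eq_add'.2 h, map_inv₀, Complex.conj_ofReal, outerNormSq]
  have h1 : (σ m : ℂ) ≠ 0 := by exact_mod_cast (hs.pos m).ne'
  have h2 : (a : ℂ) ≠ 0 := by exact_mod_cast ha.ne'
  push_cast
  field_simp

include hs in
theorem inner_restrictOuter_pswfDilated (m n : ℕ) :
    inner ℂ (restrictOuter ε (pswfDilated ha hε σ φ m))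
      (restrictOuter ε (pswfDilated ha hε σ φ n)) =
      if m = n then (outerNormSq a ε σ m : ℂ) else 0 := by
  rw [pswfDilated_eq ha hε n, map_smul, inner_smul_right,
    inner_restrictOuter_pswfDilated_synthesis ha hε hs, orthonormal_iff_ite.1 hs.orthonormal_left]
  split_ifs with h
  · subst h
    have h1 : (σ m : ℂ) ≠ 0 := by exact_mod_cast (hs.pos m).ne'
    field_simp
  · simp

include ha hε hs in
-- This number is the squared outer norm of `g_m(· / ε)`. If it vanished, the analytic function
-- would vanish on `(ε, ε + 1)`, hence identically, forcing `φ_m = 0`.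
theorem outerNormSq_pos (m : ℕ) : 0 < outerNormSq a ε σ m := by
  have h1 : ‖restrictOuter ε (pswfDilated ha hε σ φ m)‖ ^ 2 = outerNormSq a ε σ m := by
    have h := inner_restrictOuter_pswfDilated ha hε hs m m
    rw [if_pos rfl] at h
    rw [← inner_self_eq_norm_sq (𝕜 := ℂ), h]
    exact Complex.ofReal_re _
  rw [← h1]
  refine pow_pos (norm_pos_iff.2 fun h0 => ?_) 2
  have hσ : (σ m : ℂ)⁻¹ ≠ 0 := inv_ne_zero (by exact_mod_cast (hs.pos m).ne')
  rw [pswfDilated_eq, map_smul, smul_eq_zero_iff_right hσ] at h0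
  have h2 := coeFn_restrictOuter ε (synthesis ha.ne' (φ m))
  rw [h0] at h2
  have h3 : ∀ᵐ x ∂(volume.restrict (Ioo ε (ε + 1))), truncFourierFun a (φ m) x = 0 := by
    refine ae_restrict_of_ae_restrict_of_subset
      (fun x (hx : x ∈ Ioo ε (ε + 1)) (h' : x ∈ Ioo (-ε) ε) => lt_asymm hx.1 h'.2) ?_
    filter_upwards [h2, Lp.coeFn_zero ℂ 2 (volume.restrict (Ioo (-ε) ε)ᶜ),
      ae_restrict_of_ae (coeFn_synthesis ha.ne' (φ m))] with x e1 e2 e3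
    rw [← e3, ← e1, e2]
    rfl
  have h4 := eq_zero_of_truncFourierFun_eq_zero ha
    (truncFourierFun_eq_zero_of_ae_Ioo a (φ m) (by linarith) h3)
  have h5 := hs.orthonormal_left.1 m
  rw [h4, norm_zero] at h5
  exact zero_ne_one h5

include ha hε hs in
theorem rho_lt_one (m : ℕ) : rho (a * ε) σ m < 1 := by
  have h1 := outerNormSq_pos ha hε hs m
  have h2 := rho_pos ha hε hs.pos m
  rw [outerNormSq_eq ha hε hs.pos] at h1
  rw [div_pos_iff_of_pos_right h2, mul_pos_iff_of_pos_right hε] at h1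
  linarith

/-! ### The interpolation series -/

include hs in
theorem interpTerm_eq (h : L2R) (m : ℕ) : interpTerm ha hε σ φ h m =
    (inner ℂ (restrictOuter ε (pswfDilated ha hε σ φ m)) (restrictOuter ε h) /
      (outerNormSq a ε σ m : ℂ)) • pswfDilated ha hε σ φ m := by
  have h1 : (rho (a * ε) σ m : ℂ) ≠ 0 := by exact_mod_cast (rho_pos ha hε hs.pos m).ne'
  have h2 : ((1 - rho (a * ε) σ m : ℝ) : ℂ) ≠ 0 := by
    exact_mod_cast (sub_pos.2 (rho_lt_one ha hε hs m)).ne'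
  have h3 : (ε : ℂ) ≠ 0 := by exact_mod_cast hε.ne'
  rw [interpTerm, outerCoeff_eq_inner ha hε, outerNormSq_eq ha hε hs.pos, Complex.ofReal_div,
    Complex.ofReal_mul]
  congr 1
  field_simp

include ha hε hs in
theorem rho_le_rho_zero (m : ℕ) : rho (a * ε) σ m ≤ rho (a * ε) σ 0 := by
  have h1 := hs.antitone (Nat.zero_le m)
  have h2 := (hs.pos m).le
  rw [rho, rho]
  gcongr

include hs in
-- Bessel controls the coefficients weighted by outer norms; on the line the weights grow by `1 / (1
-- - ρ_m) ≤ 1 / (1 - ρ_0)`.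
theorem summable_interpTerm (h : L2R) : Summable (interpTerm ha hε σ φ h) := by
  have hpos := outerNormSq_pos ha hε hs
  have hb := (bessel_of_inner_eq hpos (inner_restrictOuter_pswfDilated ha hε hs)
    (restrictOuter ε h)).1
  rw [show interpTerm ha hε σ φ h = _ from funext (interpTerm_eq ha hε hs h)]
  refine summable_smul_of_inner_eq (t := fun m => 2 * Real.pi / (a * σ m ^ 2)) (fun m => ?_)
    (inner_pswfDilated ha hε hs) ?_
  · have := hs.pos m
    positivity
  · refine Summable.of_nonneg_of_le (fun m => ?_) (fun m => ?_)
      (hb.mul_left (1 / (1 - rho (a * ε) σ 0)))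
    · have := hs.pos m
      positivity
    · have h0 := rho_lt_one ha hε hs 0
      have hm := rho_lt_one ha hε hs m
      have hle := rho_le_rho_zero ha hε hs m
      have hr := rho_pos ha hε hs.pos m
      have e1 : 2 * Real.pi / (a * σ m ^ 2) =
          1 / (1 - rho (a * ε) σ m) * outerNormSq a ε σ m := by
        have e2 : 2 * Real.pi / (a * σ m ^ 2) = ε / rho (a * ε) σ m := by
          have := hs.pos m
          rw [rho, abs_of_pos (mul_pos ha hε)]
          field_simp
        rw [e2, outerNormSq_eq ha hε hs.pos]
        have : 1 - rho (a * ε) σ m ≠ 0 := by linarith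
        generalize rho (a * ε) σ m = r at hr this
        field_simp
      rw [e1, mul_left_comm]
      refine mul_le_mul_of_nonneg_right ?_ (mul_nonneg (sq_nonneg _) (hpos m).le)
      exact one_div_le_one_div_of_le (by linarith) (by linarith)

include hs in
-- Parseval inside and Bessel outside, compared termwise through `ε = ρ_m / (1 - ρ_m) * τ_m` and
-- `ρ_m ≤ ρ_0`.
theorem norm_sq_restrictIcc_interp_le (h : L2R) : ‖restrictIcc ε (interp ha hε σ φ h)‖ ^ 2 ≤
    rho (a * ε) σ 0 / (1 - rho (a * ε) σ 0) * ‖restrictOuter ε h‖ ^ 2 := by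
  have hpos := outerNormSq_pos ha hε hs
  obtain ⟨hb1, hb2⟩ := bessel_of_inner_eq hpos (inner_restrictOuter_pswfDilated ha hε hs)
    (restrictOuter ε h)
  have h1 := (summable_interpTerm ha hε hs h).hasSum.mapL (restrictIcc ε)
  simp only [interpTerm_eq ha hε hs, map_smul] at h1
  have h2 := hasSum_norm_sq_of_inner_eq (t := fun _ => ε) (fun _ => hε)
    (inner_restrictIcc_pswfDilated ha hε hs) h1
  have h0 := rho_lt_one ha hε hs 0
  have hr0 := rho_pos ha hε hs.pos 0
  have h3 := hasSum_le (fun m => ?_) h2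
    (hb1.hasSum.mul_left (rho (a * ε) σ 0 / (1 - rho (a * ε) σ 0)))
  · simp only [← interpTerm_eq ha hε hs] at h3
    refine h3.trans (mul_le_mul_of_nonneg_left hb2 ?_)
    exact div_nonneg hr0.le (by linarith)
  · have hm := rho_lt_one ha hε hs m
    have hle := rho_le_rho_zero ha hε hs m
    have hr := rho_pos ha hε hs.pos m
    have e1 : ε = rho (a * ε) σ m / (1 - rho (a * ε) σ m) * outerNormSq a ε σ m := by
      rw [outerNormSq_eq ha hε hs.pos]
      have : 1 - rho (a * ε) σ m ≠ 0 := by linarith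
      generalize rho (a * ε) σ m = r at hr this
      field_simp
    rw [mul_left_comm]
    refine mul_le_mul_of_nonneg_left ?_ (sq_nonneg _)
    refine e1.le.trans (mul_le_mul_of_nonneg_right ?_ (hpos m).le)
    exact div_le_div₀ hr0.le hle (by linarith) (by linarith)

include hs in
-- For `u = S ψ` the outer coefficient divided by `τ_m` is `σ_m ⟨ψ, φ_m⟩`, so the series is the
-- image under `S` of the expansion of `ψ` in `(φ_m)`.
theorem interp_eq_self_of_mem_paleyWiener {u : L2R} (hu : u ∈ paleyWiener a) :
    interp ha hε σ φ u = u := by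
  obtain ⟨ψ, rfl⟩ := exists_synthesis_eq_of_mem_paleyWiener ha hu
  have h1 := (hs.hasSum_left (truncFourier_injective (mul_pos ha hε)) ψ).map
    (synthesis ha.ne') (continuous_synthesis ha)
  refine HasSum.tsum_eq ?_
  convert h1 using 1
  ext1 m
  have hσ : (σ m : ℂ) ≠ 0 := by exact_mod_cast (hs.pos m).ne'
  have hn : (outerNormSq a ε σ m : ℂ) ≠ 0 := by exact_mod_cast (outerNormSq_pos ha hε hs m).ne'
  rw [interpTerm_eq ha hε hs, inner_restrictOuter_pswfDilated_synthesis ha hε hs,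
    mul_div_cancel_left₀ _ hn, pswfDilated_eq, smul_smul, Function.comp_apply, map_smul]
  congr 1
  field_simp

/-! ### The error estimate on `[-ε,ε]` -/

include hs in
theorem interp_sub (f h : L2R) :
    interp ha hε σ φ (f - h) = interp ha hε σ φ f - interp ha hε σ φ h := by
  rw [interp, interp, interp,
    ← (summable_interpTerm ha hε hs f).tsum_sub (summable_interpTerm ha hε hs h)]
  congr 1
  ext1 m
  simp only [interpTerm_eq ha hε hs]
  rw [← sub_smul, map_sub, inner_sub_right, sub_div]

include ha hε hs in
-- From `‖F_c‖ ≤ 2` one gets `σ_0 ≤ 2`, so `ρ_0 ≤ 2c / π`; the second factor `1 - ρ_0 < 1` in the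
-- denominator of `C0` is slack.
theorem two_mul_rho_div_le_C0 :
    2 * (rho (a * ε) σ 0 / (1 - rho (a * ε) σ 0)) ≤ C0 (a * ε) σ := by
  have h0 := rho_lt_one ha hε hs 0
  have hr0 := rho_pos ha hε hs.pos 0
  have hc := mul_pos ha hε
  have hσ : σ 0 ≤ 2 := by
    have h1 := (truncFourier (a * ε)).le_opNorm (φ 0)
    rw [hs.map_eq, norm_smul, hs.orthonormal_left.1, hs.orthonormal_right.1, mul_one, mul_one,
      Complex.norm_real, Real.norm_of_nonneg (hs.pos 0).le] at h1
    exact h1.trans (norm_truncFourier_le _)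
  have hr : rho (a * ε) σ 0 * Real.pi ≤ 2 * (a * ε) := by
    rw [rho, abs_of_pos hc, div_mul_eq_mul_div, div_le_iff₀ (by positivity)]
    have h4 : σ 0 ^ 2 ≤ 4 := by nlinarith [hs.pos 0]
    nlinarith [mul_le_mul_of_nonneg_left h4 (mul_pos hc Real.pi_pos).le]
  have h1 : 0 < 1 - rho (a * ε) σ 0 := by linarith
  rw [C0, mul_div_assoc', div_le_div_iff₀ h1 (by positivity)]
  have h2 : 2 * (rho (a * ε) σ 0 * Real.pi) * (1 - rho (a * ε) σ 0) ≤ 4 * (a * ε) := by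
    nlinarith [mul_pos hr0 Real.pi_pos]
  nlinarith [mul_le_mul_of_nonneg_right h2 h1.le]

include hs in
theorem norm_sq_restrictIcc_sub_interp_le (f h : L2R) :
    ‖restrictIcc ε (f - interp ha hε σ φ h)‖ ^ 2 ≤
      2 * (1 + C0 (a * ε) σ) * ‖f - paleyWienerProj a f‖ ^ 2 +
      2 * C0 (a * ε) σ * ∫ x in (Ioo (-ε) ε)ᶜ, ‖f x - h x‖ ^ 2 := by
  rw [← norm_sq_restrictOuter_sub]
  set p := paleyWienerProj a f with hp
  have hpi : interp ha hε σ φ p = p :=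
    interp_eq_self_of_mem_paleyWiener ha hε hs (paleyWienerProj_mem a f)
  have e1 : f - interp ha hε σ φ h = (f - p) + interp ha hε σ φ (p - h) := by
    rw [interp_sub ha hε hs, hpi]; abel
  have e2 : p - h = -(f - p) + (f - h) := by abel
  have h1 := norm_sq_eq_restrict_add ε (f - p)
  have h2 := norm_sq_restrictIcc_interp_le ha hε hs (p - h)
  have h3 := two_mul_rho_div_le_C0 ha hε hs
  set K := rho (a * ε) σ 0 / (1 - rho (a * ε) σ 0)
  have hK : 0 ≤ K := div_nonneg (rho_pos ha hε hs.pos 0).le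
    (by linarith [rho_lt_one ha hε hs 0])
  have sq_add_le : ∀ {x y z : ℝ}, 0 ≤ x → x ≤ y + z → x ^ 2 ≤ 2 * y ^ 2 + 2 * z ^ 2 := by
    intro x y z hx hxy
    nlinarith [sq_nonneg (y - z)]
  have h4 : ‖restrictOuter ε (p - h)‖ ^ 2 ≤
      2 * ‖restrictOuter ε (f - p)‖ ^ 2 + 2 * ‖restrictOuter ε (f - h)‖ ^ 2 := by
    refine sq_add_le (norm_nonneg _) ?_
    rw [e2, map_add, map_neg]
    exact (norm_add_le _ _).trans (by rw [norm_neg])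
  have h5 : ‖restrictIcc ε (f - interp ha hε σ φ h)‖ ^ 2 ≤
      2 * ‖restrictIcc ε (f - p)‖ ^ 2 + 2 * ‖restrictIcc ε (interp ha hε σ φ (p - h))‖ ^ 2 := by
    refine sq_add_le (norm_nonneg _) ?_
    rw [e1, map_add]
    exact norm_add_le _ _
  have hR := sq_nonneg ‖restrictIcc ε (f - p)‖
  have hS := sq_nonneg ‖restrictOuter ε (f - p)‖
  have hT := sq_nonneg ‖restrictOuter ε (f - h)‖
  have h6 := mul_le_mul_of_nonneg_left h4 hK
  have h7 := mul_le_mul_of_nonneg_right h3 (add_nonneg hS hT)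
  have hC : 0 ≤ C0 (a * ε) σ := by linarith
  rw [h1]
  -- With `A`, `B` the squared inner and outer norms of `f - p` and `T` the squared outer norm of `f
  -- - h`, the chain is `2A + 4K(B + T) ≤ 2A + 2 C0 (B + T) ≤ 2 (1 + C0)(A + B) + 2 C0 T`.
  nlinarith [mul_nonneg hC hR]

end Prolate

end PSWF

theorem proposition3 (a ε : ℝ) (ha : 0 < a) (hε : 0 < ε) :
    (∃ (σ : ℕ → ℝ) (φ g : ℕ → PSWF.L2I),
      PSWF.IsSingularSystem (PSWF.truncFourier (a * ε)) σ φ g) ∧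
    ∀ (σ : ℕ → ℝ) (φ g : ℕ → PSWF.L2I),
      PSWF.IsSingularSystem (PSWF.truncFourier (a * ε)) σ φ g →
      (∀ m, PSWF.rho (a * ε) σ m < 1) ∧
      (∀ h : PSWF.L2R, Summable (PSWF.interpTerm ha hε σ φ h) ∧
        HasSum (fun m => PSWF.restrictIcc ε (PSWF.interpTerm ha hε σ φ h m))
          (PSWF.restrictIcc ε (PSWF.interp ha hε σ φ h))) ∧
      (∀ u ∈ PSWF.paleyWiener a, PSWF.interp ha hε σ φ u = u) ∧
      (∀ f h : PSWF.L2R,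
        ‖PSWF.restrictIcc ε (f - PSWF.interp ha hε σ φ h)‖ ^ 2 ≤
          2 * (1 + PSWF.C0 (a * ε) σ) * ‖f - PSWF.paleyWienerProj a f‖ ^ 2 +
          2 * PSWF.C0 (a * ε) σ * ∫ x in (Set.Ioo (-ε) ε)ᶜ, ‖f x - h x‖ ^ 2) := by
  refine ⟨PSWF.exists_isSingularSystem_truncFourier (mul_pos ha hε), fun σ φ g hs =>
    ⟨PSWF.rho_lt_one ha hε hs, fun h => ?_,
      fun u hu => PSWF.interp_eq_self_of_mem_paleyWiener ha hε hs hu,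
      PSWF.norm_sq_restrictIcc_sub_interp_le ha hε hs⟩⟩
  -- Summability ensures that `interp`, defined by `∑'`, is the sum of the series and not the
  -- default value `0`.
  have := PSWF.summable_interpTerm ha hε hs h
  exact ⟨this, this.hasSum.mapL (PSWF.restrictIcc ε)⟩
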